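/- **Conventions.** Graphs are finite and simple; $d(v)$ is the degree of $v$ in $G$ and $\delta(G)$ the minimum degree. An *outer-1-plane graph* is a graph $G$ together with a drawing in the plane in which all vertices lie on the outer face and each edge is crossed at most once. As usual, such a drawing is represented, up to topological equivalence, by placing the vertices at distinct points of a circle and drawing each edge as the straight chord between its ends, so that two edges cross if and only if their ends alternate on the circle. A graph is *outer-1-planar* if it has such a drawing. **Configurations.** Each configuration is a picture: a small graph whose vertices are marked *solid* or *hollow*, some hollow vertices carrying the restriction "degree at most $7$". $G$ *contains* the configuration if $G$ has a (not necessarily induced) subgraph equal to a copy of it in which every solid vertex has degree in $G$ exactly, and every hollow vertex at least, the number of edges incident with it in the picture, and in which the restricted hollow vertices have degree at most $7$ in $G$. Distinct vertices of the picture correspond to distinct vertices of $G$. The configurations are as follows. * $G_1$: two adjacent vertices, both of degree exactly $2$ (their other neighbours are not part of the picture and may coincide). * $G_2$: a triangle with one vertex of degree exactly $2$, one vertex of degree exactly $3$, and a hollow vertex. * $G_3$: vertices $x,u,v,y$ with edges $xu,xv,uy,vy$; $u,v$ are solid (degree $2$), $x,y$ are hollow, and $d(y)\le 7$. * $G_4$: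 vertices $a,u,b,w,c$ with edges $au,ub,ab,bw,wc,bc$; $u,b,w$ are solid (degrees $2,4,2$), $a,c$ are hollow. * $G_5$: vertices $a,u,b,w,c,d$ with edges $au,ub,ab,bw,wc,bd$; $u,b,w$ are solid (degrees $2,4,2$), $a,c,d$ are hollow. For $6\le i\le 17$, the vertices of $G_i$ are $p_0,p_1,\dots,p_m$, drawn in this cyclic order in convex position with straight edges; $p_0,p_m$ are hollow and all other vertices are solid. The edges are the path edges $p_0p_1,p_1p_2,\dots,p_{m-1}p_m$ together with the following chords, where the first two cross each other: * $G_6$: $m=3$; $p_0p_2,\ p_1p_3$; restriction $d(p_3)\le 7$. * $G_7$: $m=4$; $p_0p_3,\ p_1p_4$; restriction $d(p_4)\le 7$. * $G_8$: $m=4$; $p_0p_2,\ p_1p_4$. * $G_9$: $m=5$; $p_0p_3,\ p_2p_5$. * $G_{10}$: $m=5$; $p_0p_3,\ p_1p_5$. * $G_{11}$: $m=6$; $p_0p_4,\ p_2p_6$. * $G_{12}$: the chords of $G_7$ and $p_1p_3$; restriction $d(p_4)\le 7$. * $G_{13}$: the chords of $G_8$ and $p_2p_4$. * $G_{14}$: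 the chords of $G_9$ and $p_0p_2$. * $G_{15}$: the chords of $G_{10}$ and $p_1p_3,\ p_3p_5$. * $G_{16}$: the chords of $G_9$ and $p_0p_2,\ p_3p_5$. * $G_{17}$: the chords of $G_{11}$ and $p_0p_2,\ p_2p_4,\ p_4p_6$. **Theorem.** Let $G$ be an outer-1-plane graph with $\delta(G)\ge 2$. Then $G$ contains a copy of at least one of the configurations $G_1,\dots,G_{17}$ such that * ($\mathfrak D_1$) if the configuration is $G_3$, then the graph obtained from $G$ by adding the edge $uv$ is still outer-1-planar (with respect to some drawing); * ($\mathfrak D_2$) if the configuration is $G_i$ with $6\le i\le 17$, then the picture of $G_i$ is, up to inversion, a partial drawing of the given drawing of $G$: the vertices of the copy occur on the circle in the cyclic order $p_0,p_1,\dots,p_m$, clockwise or counterclockwise (so edges of the copy cross exactly as in the picture). -/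

import Mathlib

namespace OuterOnePlane

/-! ### Outer-1-plane graphs -/

/-- With the vertices placed at the points `pos` of the unit circle and the edges drawn as straight
chords, the drawn edges `ab` and `cd` cross: the two chords, without their ends, meet.  (Two distinct
chords meet in at most one point, and two distinct chords with a common end never cross.) -/
def Cross {V : Type*} (pos : V → Circle) (a b c d : V) : Prop :=
  (openSegment ℝ (pos a : ℂ) (pos b : ℂ) ∩ openSegment ℝ (pos c : ℂ) (pos d : ℂ)).Nonempty

/-- An outer-1-plane drawing of `G`, in convex form: the vertices are distinct points of a fixed
circle (so that all of them are on the outer face), the edges are drawn inside the disk, as the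
chords between their ends, and each edge is crossed at most once. -/
structure Drawing {V : Type*} (G : SimpleGraph V) where
  pos : V → Circle
  pos_injective : Function.Injective pos
  crossed_at_most_once : ∀ a b c d c' d' : V, G.Adj a b → G.Adj c d → G.Adj c' d' →
    s(c, d) ≠ s(a, b) → s(c', d') ≠ s(a, b) →
    Cross pos a b c d → Cross pos a b c' d' → s(c, d) = s(c', d')

/-- `G` is outer-1-planar: it has an outer-1-plane drawing. -/
def IsOuterOnePlanar {V : Type*} (G : SimpleGraph V) : Prop :=
  Nonempty (Drawing G)

/-- The points `a`, `b`, `c` of the plane form a counterclockwise oriented triangle. -/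
def Ccw (a b c : ℂ) : Prop :=
  0 < (b.re - a.re) * (c.im - a.im) - (b.im - a.im) * (c.re - a.re)

/-! ### Configurations -/

/-- The picture of a configuration.  Its vertices are `0, …, size - 1`.  For the pictures that are
regarded as drawings, the vertices are in convex position in this cyclic order and the edges are
straight, so that two edges cross exactly if their ends alternate in the cyclic order. -/
structure Picture where
  size : ℕ
  /-- The edges with both ends drawn. -/
  edges : Finset (Sym2 (Fin size))
  /-- The solid vertices (exact degree); the other vertices are hollow (degree bounded below). -/
  solid : Finset (Fin size)
  /-- The marked hollow vertices: those with the additional restriction that the degree is at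
  most `7`. -/
  marked : Finset (Fin size) := ∅
  /-- The number of edges drawn at a vertex towards an end that is not drawn. -/
  halfEdges : Fin size → ℕ := fun _ => 0

/-- The number of edges incident with the vertex `i` in the picture. -/
def Picture.degree (P : Picture) (i : Fin P.size) : ℕ :=
  (P.edges.filter (fun e => i ∈ e)).card + P.halfEdges i

/-- `f` maps the picture `P` onto a copy of it in `G`: a (not necessarily induced) subgraph
of `G` in which each solid vertex has exactly, and each hollow vertex at least, the degree in `G`
that it has in the picture, and in which the marked vertices have degree at most `7` in `G`. -/
structure IsCopy {V : Type*} [Fintype V] (G : SimpleGraph V) [DecidableRel G.Adj]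
    (P : Picture) (f : Fin P.size → V) : Prop where
  injective : Function.Injective f
  adj : ∀ i j, s(i, j) ∈ P.edges → G.Adj (f i) (f j)
  degree_solid : ∀ i ∈ P.solid, G.degree (f i) = P.degree i
  degree_hollow : ∀ i, i ∉ P.solid → P.degree i ≤ G.degree (f i)
  degree_marked : ∀ i ∈ P.marked, G.degree (f i) ≤ 7

/-- The picture with its vertices at `f 0, …, f (k - 1)` is a partial drawing, up to inversion, of
the drawing `D`: the vertices `f 0, …, f (k - 1)` are met in this cyclic order when the circle is
traversed counterclockwise, or they are when it is traversed clockwise. -/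
def Drawing.IsPartialDrawing {V : Type*} {G : SimpleGraph V} (D : Drawing G) {k : ℕ}
    (f : Fin k → V) : Prop :=
  (∀ i j l : Fin k, i < j → j < l → Ccw (D.pos (f i)) (D.pos (f j)) (D.pos (f l))) ∨
  (∀ i j l : Fin k, i < j → j < l → Ccw (D.pos (f l)) (D.pos (f j)) (D.pos (f i)))

/-- Two adjacent vertices of degree `2` (their other neighbours are not drawn and may coincide). -/
def G1 : Picture where
  size := 2
  edges := {s(0, 1)}
  solid := {0, 1}
  halfEdges := ![1, 1]

/-- A triangle with a vertex of degree `2` and a vertex of degree `3`. -/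
def G2 : Picture where
  size := 3
  edges := {s(0, 1), s(0, 2), s(1, 2)}
  solid := {0, 1}
  halfEdges := ![0, 1, 0]

/-- Two vertices `u = 1`, `v = 2` of degree `2` with the same neighbours `x = 0`, `y = 3`, where
the degree of `y` is at most `7`. -/
def G3 : Picture where
  size := 4
  edges := {s(0, 1), s(0, 2), s(1, 3), s(2, 3)}
  solid := {1, 2}
  marked := {3}

/-- Two triangles with a common vertex `2` of degree `4`, each with a vertex of degree `2`. -/
def G4 : Picture where
  size := 5
  edges := {s(0, 1), s(1, 2), s(0, 2), s(2, 3), s(3, 4), s(2, 4)}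
  solid := {1, 2, 3}

/-- A vertex `2` of degree `4` that has two neighbours `1`, `3` of degree `2`, of which `1` forms a
triangle with `2` and the neighbour `0` of `2`, and the other neighbour `4` of `3` is not a
neighbour of `2` (the fourth neighbour of `2` is `5`). -/
def G5 : Picture where
  size := 6
  edges := {s(0, 1), s(1, 2), s(0, 2), s(2, 3), s(3, 4), s(2, 5)}
  solid := {1, 2, 3}

/-- Path `0 1 2 3` with the crossing chords `02`, `13`; here `u = 1`, `v = 2`, `x = 0`, and `y = 3`
has degree at most `7`. -/
def G6 : Picture where
  size := 4
  edges := {s(0, 1), s(1, 2), s(2, 3), s(0, 2), s(1, 3)}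
  solid := {1, 2}
  marked := {3}

/-- Path `0 1 2 3 4` with the crossing chords `03`, `14`; the end `y = 4` has degree at most `7`.
-/
def G7 : Picture where
  size := 5
  edges := {s(0, 1), s(1, 2), s(2, 3), s(3, 4), s(0, 3), s(1, 4)}
  solid := {1, 2, 3}
  marked := {4}

/-- Path `0 1 2 3 4` with the crossing chords `02`, `14`. -/
def G8 : Picture where
  size := 5
  edges := {s(0, 1), s(1, 2), s(2, 3), s(3, 4), s(0, 2), s(1, 4)}
  solid := {1, 2, 3}

/-- Path `0 1 2 3 4 5` with the crossing chords `03`, `25`. -/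
def G9 : Picture where
  size := 6
  edges := {s(0, 1), s(1, 2), s(2, 3), s(3, 4), s(4, 5), s(0, 3), s(2, 5)}
  solid := {1, 2, 3, 4}

/-- Path `0 1 2 3 4 5` with the crossing chords `03`, `15`. -/
def G10 : Picture where
  size := 6
  edges := {s(0, 1), s(1, 2), s(2, 3), s(3, 4), s(4, 5), s(0, 3), s(1, 5)}
  solid := {1, 2, 3, 4}

/-- Path `0 1 2 3 4 5 6` with the crossing chords `04`, `26`. -/
def G11 : Picture where
  size := 7
  edges := {s(0, 1), s(1, 2), s(2, 3), s(3, 4), s(4, 5), s(5, 6), s(0, 4), s(2, 6)}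
  solid := {1, 2, 3, 4, 5}

/-- `G7` with the additional edge `13`. -/
def G12 : Picture where
  size := 5
  edges := {s(0, 1), s(1, 2), s(2, 3), s(3, 4), s(0, 3), s(1, 4), s(1, 3)}
  solid := {1, 2, 3}
  marked := {4}

/-- `G8` with the additional edge `24`. -/
def G13 : Picture where
  size := 5
  edges := {s(0, 1), s(1, 2), s(2, 3), s(3, 4), s(0, 2), s(1, 4), s(2, 4)}
  solid := {1, 2, 3}

/-- `G9` with the additional edge `02`. -/
def G14 : Picture where
  size := 6
  edges := {s(0, 1), s(1, 2), s(2, 3), s(3, 4), s(4, 5), s(0, 3), s(2, 5), s(0, 2)}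
  solid := {1, 2, 3, 4}

/-- `G10` with the additional edges `13`, `35`. -/
def G15 : Picture where
  size := 6
  edges := {s(0, 1), s(1, 2), s(2, 3), s(3, 4), s(4, 5), s(0, 3), s(1, 5), s(1, 3), s(3, 5)}
  solid := {1, 2, 3, 4}

/-- `G9` with the additional edges `02`, `35`. -/
def G16 : Picture where
  size := 6
  edges := {s(0, 1), s(1, 2), s(2, 3), s(3, 4), s(4, 5), s(0, 3), s(2, 5), s(0, 2), s(3, 5)}
  solid := {1, 2, 3, 4}

/-- `G11` with the additional edges `02`, `24`, `46`. -/
def G17 : Picture where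
  size := 7
  edges := {s(0, 1), s(1, 2), s(2, 3), s(3, 4), s(4, 5), s(5, 6), s(0, 4), s(2, 6),
    s(0, 2), s(2, 4), s(4, 6)}
  solid := {1, 2, 3, 4, 5}

end OuterOnePlane

/-!
Cutting the circle at a point turns the drawing into a graph on a line, in which two edges cross if
and only if their ends alternate (`Cross.alternate`, `Alternate.cross`).  Call an interval from `a`
to `b` isolated if no edge leaves its interior to the outside.  Since each edge is crossed at most
once, an isolated interval with inner vertices either splits at an inner vertex into two isolated
intervals, or it is spanned by two crossing edges `ay`, `xb` with `a < x < y < b`, and its three parts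
`ax`, `xy`, `yb` are isolated (`OneCrossing.decompose`).

Suppose that there is no configuration.  By induction on the number of inner vertices, every isolated
interval is short (at most one inner vertex, which is joined to both ends) or tight (two crossing
edges around a short interval), see `Isolated.short_or_tight`.  Indeed, a tight interval contains
`G3`, `G6`, `G7` or `G12` as soon as one of its ends has degree at most `7`.  The end of a short or
tight interval has at most three neighbours in it, and a vertex at which two parts of an interval meet
has at most one further edge.  So it has degree at most `3 + 3 + 1`, and all parts are short.  There
are only finitely many ways to put short intervals together, and `hasConfiguration_or_short` and
`hasConfiguration_or_tight` check that each of them gives a configuration or a short or tight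
interval.

Finally, the interval of all vertices is isolated, and if it is short or tight, then the degree of
its ends is small, and there is a configuration after all (`OneCrossing.hasConfiguration`).
-/

namespace OuterOnePlane

open Complex

/-! ### Chords of the circle -/

/-- Twice the signed area of the triangle `abc`; `Ccw a b c` says that it is positive. -/
def orient (a b c : ℂ) : ℝ :=
  (b.re - a.re) * (c.im - a.im) - (b.im - a.im) * (c.re - a.re)

theorem orient_swap (a b c : ℂ) : orient a c b = -orient a b c := by
  unfold orient; ring

theorem orient_rotate (a b c : ℂ) : orient b c a = orient a b c := by
  unfold orient; ring

theorem orient_left (a b : ℂ) : orient a b a = 0 := by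
  unfold orient; ring

theorem orient_right (a b : ℂ) : orient a b b = 0 := by
  unfold orient; ring

theorem orient_combo (a b c d : ℂ) {s t : ℝ} (hst : s + t = 1) :
    orient a b (s • c + t • d) = s * orient a b c + t * orient a b d := by
  obtain rfl : t = 1 - s := by linarith
  simp only [orient, add_re, add_im, real_smul, mul_re, mul_im, ofReal_re, ofReal_im]
  ring

/-- Two chords meet if the ends of each lie on different sides of the other. -/
theorem segments_meet {a b c d : ℂ} (h₁ : orient a b c < 0) (h₂ : 0 < orient a b d)
    (h₃ : 0 < orient c d a) (h₄ : orient c d b < 0) :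
    (openSegment ℝ a b ∩ openSegment ℝ c d).Nonempty := by
  have hs : 0 < orient a b d - orient a b c := by linarith
  have he : orient c d a - orient c d b = orient a b d - orient a b c := by
    unfold orient; ring
  refine ⟨(orient a b d / (orient a b d - orient a b c)) • c +
    (-orient a b c / (orient a b d - orient a b c)) • d,
    ⟨-orient c d b / (orient a b d - orient a b c), orient c d a / (orient a b d - orient a b c),
      div_pos (by linarith) hs, div_pos h₃ hs, ?_, ?_⟩,
    ⟨_, _, div_pos h₂ hs, div_pos (by linarith) hs, ?_, rfl⟩⟩
  · rw [← add_div, ← he, div_eq_one_iff_eq (by linarith)]; ring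
  · have hs' := hs.ne'
    apply Complex.ext <;>
      simp only [add_re, add_im, real_smul, mul_re, mul_im, ofReal_re, ofReal_im, zero_mul,
        sub_zero, add_zero] <;> field_simp <;> unfold orient <;> ring
  · rw [← add_div, div_eq_one_iff_eq hs.ne']; ring

/-- Points of the circle whose arguments increase are met in counterclockwise order. -/
theorem orient_pos_of_arg {a b c : Circle} (hab : arg a < arg b) (hbc : arg b < arg c) :
    0 < orient a b c := by
  have key : ∀ z : Circle, (z : ℂ).re = Real.cos (arg z) ∧ (z : ℂ).im = Real.sin (arg z) := by
    intro z
    have hz : ‖(z : ℂ)‖ = 1 := Circle.norm_coe z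
    constructor
    · rw [cos_arg z.coe_ne_zero, hz, div_one]
    · rw [sin_arg, hz, div_one]
  have h1 := neg_pi_lt_arg (a : ℂ)
  have h2 := arg_le_pi (c : ℂ)
  obtain ⟨A, hA⟩ : ∃ A, A = (arg b - arg a) / 2 := ⟨_, rfl⟩
  obtain ⟨B, hB⟩ : ∃ B, B = (arg c - arg b) / 2 := ⟨_, rfl⟩
  have hb : arg b = arg a + 2 * A := by rw [hA]; ring
  have hc : arg c = arg a + 2 * A + 2 * B := by rw [hA, hB]; ring
  have : orient a b c = 4 * Real.sin A * Real.sin B * Real.sin (A + B) := by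
    have h1 : orient a b c =
        Real.sin (arg b - arg a) + Real.sin (arg c - arg b) - Real.sin (arg c - arg a) := by
      unfold orient
      rw [(key a).1, (key a).2, (key b).1, (key b).2, (key c).1, (key c).2]
      simp only [Real.sin_sub]
      ring
    rw [h1, hc, hb, show arg (a : ℂ) + 2 * A - arg (a : ℂ) = 2 * A by ring,
      show arg (a : ℂ) + 2 * A + 2 * B - (arg (a : ℂ) + 2 * A) = 2 * B by ring,
      show arg (a : ℂ) + 2 * A + 2 * B - arg (a : ℂ) = 2 * A + 2 * B by ring]
    simp only [Real.sin_add, Real.sin_two_mul, Real.cos_two_mul]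
    linear_combination (-4 * Real.sin A * Real.cos A) * Real.sin_sq_add_cos_sq B -
      4 * Real.sin B * Real.cos B * Real.sin_sq_add_cos_sq A
  rw [this]
  have p1 : 0 < Real.sin A := Real.sin_pos_of_pos_of_lt_pi (by linarith) (by linarith)
  have p2 : 0 < Real.sin B := Real.sin_pos_of_pos_of_lt_pi (by linarith) (by linarith)
  have p3 : 0 < Real.sin (A + B) := Real.sin_pos_of_pos_of_lt_pi (by linarith) (by linarith)
  positivity

theorem Cross.swap_left {V : Type*} {pos : V → Circle} {a b c d : V} (h : Cross pos a b c d) :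
    Cross pos b a c d := by
  unfold Cross at *; rwa [openSegment_symm]

theorem Cross.swap_right {V : Type*} {pos : V → Circle} {a b c d : V} (h : Cross pos a b c d) :
    Cross pos a b d c := by
  unfold Cross at *; rwa [openSegment_symm ℝ (pos d : ℂ)]

/-! ### Drawings as linear orders -/

/-- The positions of the ends of the edges `ab` and `cd`, each edge being listed from left to right,
alternate on the line. -/
def Alternate {V W : Type*} [LinearOrder W] (p : V → W) (a b c d : V) : Prop :=
  (p a < p c ∧ p c < p b ∧ p b < p d) ∨ (p c < p a ∧ p a < p d ∧ p d < p b)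

/-- With the vertices placed on a line at the positions `p`, each edge of `G` alternates with at
most one other edge. -/
def OneCrossing {V W : Type*} [LinearOrder W] (p : V → W) (G : SimpleGraph V) : Prop :=
  ∀ a b c d c' d', G.Adj a b → G.Adj c d → G.Adj c' d' →
    Alternate p a b c d → Alternate p a b c' d' → c = c' ∧ d = d'

theorem Alternate.cross {V : Type*} {pos : V → Circle} {a b c d : V}
    (h : Alternate (fun v => arg (pos v)) a b c d) : Cross pos a b c d := by
  rcases h with ⟨h1, h2, h3⟩ | ⟨h1, h2, h3⟩
  · have e1 := orient_pos_of_arg h1 h2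
    have e2 := orient_pos_of_arg (h1.trans h2) h3
    have e3 := orient_pos_of_arg h1 (h2.trans h3)
    have e4 := orient_pos_of_arg h2 h3
    apply segments_meet
    · rw [orient_swap] at e1; linarith
    · exact e2
    · rwa [orient_rotate]
    · rw [orient_swap] at e4; linarith
  · have e1 := orient_pos_of_arg h1 h2
    have e2 := orient_pos_of_arg (h1.trans h2) h3
    have e3 := orient_pos_of_arg h1 (h2.trans h3)
    have e4 := orient_pos_of_arg h2 h3
    unfold Cross
    rw [Set.inter_comm]
    apply segments_meet
    · rw [orient_swap] at e1; linarith
    · exact e2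
    · rwa [orient_rotate]
    · rw [orient_swap] at e4; linarith

theorem Cross.alternate {V : Type*} {pos : V → Circle} (hpos : Function.Injective pos)
    {a b c d : V} (hab : arg (pos a) < arg (pos b)) (hcd : arg (pos c) < arg (pos d))
    (hne : s(c, d) ≠ s(a, b)) (h : Cross pos a b c d) :
    Alternate (fun v => arg (pos v)) a b c d := by
  have hinj : ∀ {u v : V}, arg (pos u) = arg (pos v) → u = v := by
    intro u v huv
    exact hpos (Circle.injective_arg huv)
  obtain ⟨z, ⟨s, t, hs, ht, hst, rfl⟩, ⟨s', t', hs', ht', hst', hz⟩⟩ := h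
  have key : s' * orient (pos a) (pos b) (pos c) + t' * orient (pos a) (pos b) (pos d) = 0 := by
    rw [← orient_combo _ _ _ _ hst', hz, orient_combo _ _ _ _ hst, orient_left, orient_right]
    ring
  -- The side of the chord `ab` on which a point lies, in terms of its position on the line.
  have side : ∀ v, (arg (pos v) < arg (pos a) ∧ 0 < orient (pos a) (pos b) (pos v)) ∨ v = a ∨
      ((arg (pos a) < arg (pos v) ∧ arg (pos v) < arg (pos b)) ∧
        orient (pos a) (pos b) (pos v) < 0) ∨ v = b ∨
      (arg (pos b) < arg (pos v) ∧ 0 < orient (pos a) (pos b) (pos v)) := by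
    intro v
    rcases lt_trichotomy (arg (pos v : ℂ)) (arg (pos a)) with h | h | h
    · exact Or.inl ⟨h, by rw [orient_rotate]; exact orient_pos_of_arg h hab⟩
    · exact Or.inr (Or.inl (hinj h))
    rcases lt_trichotomy (arg (pos v : ℂ)) (arg (pos b)) with h' | h' | h'
    · refine Or.inr (Or.inr (Or.inl ⟨⟨h, h'⟩, ?_⟩))
      have := orient_pos_of_arg h h'
      rw [orient_swap] at this; linarith
    · exact Or.inr (Or.inr (Or.inr (Or.inl (hinj h'))))
    · exact Or.inr (Or.inr (Or.inr (Or.inr ⟨h', orient_pos_of_arg hab h'⟩)))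
  have pp : ∀ {x y : ℝ}, 0 < x → 0 < y → s' * x + t' * y = 0 → False := fun hx hy h => by
    have := mul_pos hs' hx; have := mul_pos ht' hy; linarith
  have nn : ∀ {x y : ℝ}, x < 0 → y < 0 → s' * x + t' * y = 0 → False := fun hx hy h => by
    have := mul_neg_of_pos_of_neg hs' hx; have := mul_neg_of_pos_of_neg ht' hy; linarith
  rcases side c with ⟨hc, oc⟩ | rfl | ⟨⟨hc, hc'⟩, oc⟩ | rfl | ⟨hc, oc⟩ <;>
  rcases side d with ⟨hd, od⟩ | rfl | ⟨⟨hd, hd'⟩, od⟩ | rfl | ⟨hd, od⟩ <;>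
  (try simp only [orient_left, orient_right, mul_zero, add_zero, zero_add, mul_eq_zero, hs'.ne',
    ht'.ne', false_or] at key) <;>
  first
  | exact absurd rfl hne
  | exact absurd hcd (lt_irrefl _)
  | exact absurd hcd (lt_asymm hab)
  | exact (pp oc od key).elim
  | exact (nn oc od key).elim
  | exact Or.inl ⟨hc, hc', hd⟩
  | exact Or.inr ⟨hc, hd, hd'⟩
  | (exfalso; linarith)

/-- In the order of the arguments, the edges of a drawing alternate as they cross. -/
theorem Drawing.oneCrossing {V : Type*} {G : SimpleGraph V} (D : Drawing G) :
    OneCrossing (fun v => arg (D.pos v)) G := by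
  have hlt : ∀ {a b c d : V}, Alternate (fun v => arg (D.pos v)) a b c d →
      arg (D.pos a) < arg (D.pos b) ∧ arg (D.pos c) < arg (D.pos d) ∧ s(c, d) ≠ s(a, b) := by
    intro a b c d h
    have hne : c ≠ a ∧ c ≠ b := by
      constructor <;> rintro rfl <;> rcases h with ⟨h1, h2, h3⟩ | ⟨h1, h2, h3⟩ <;>
        simp only at h1 h2 h3 <;> linarith
    have h' : s(c, d) ≠ s(a, b) := by
      simp [hne.1, hne.2]
    rcases h with ⟨h1, h2, h3⟩ | ⟨h1, h2, h3⟩ <;> simp only at h1 h2 h3 <;>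
      exact ⟨by linarith, by linarith, h'⟩
  intro a b c d c' d' hab hcd hcd' h h'
  have e := D.crossed_at_most_once a b c d c' d' hab hcd hcd' (hlt h).2.2 (hlt h').2.2
    h.cross h'.cross
  have l1 := (hlt h).2.1
  have l2 := (hlt h').2.1
  rcases Sym2.eq_iff.1 e with e | ⟨rfl, rfl⟩
  · exact e
  · exact absurd l1 (lt_asymm l2)

/-- A placement of the vertices on the circle is a drawing if each edge alternates with at most one
other edge in the order of the arguments. -/
theorem isOuterOnePlanar_of_oneCrossing {V : Type*} {G : SimpleGraph V} {pos : V → Circle}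
    (hpos : Function.Injective pos) (h : OneCrossing (fun v => arg (pos v)) G) :
    IsOuterOnePlanar G := by
  refine ⟨⟨pos, hpos, ?_⟩⟩
  have hinj : ∀ {u v : V}, G.Adj u v → arg (pos u : ℂ) ≠ arg (pos v) := by
    intro u v huv e
    exact huv.ne (hpos (Circle.injective_arg e))
  have order : ∀ {u v}, G.Adj u v → ∃ u' v', G.Adj u' v' ∧ s(u', v') = s(u, v) ∧
      arg (pos u' : ℂ) < arg (pos v') ∧
      ∀ {x y}, (Cross pos u v x y → Cross pos u' v' x y) ∧
        (Cross pos x y u v → Cross pos x y u' v') := by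
    intro u v huv
    rcases lt_or_gt_of_ne (hinj huv) with e | e
    · exact ⟨u, v, huv, rfl, e, id, id⟩
    · exact ⟨v, u, huv.symm, Sym2.eq_swap, e, Cross.swap_left, Cross.swap_right⟩
  intro a b c d c' d' hab hcd hcd' hne hne' hx hx'
  obtain ⟨a₁, b₁, hab₁, e, l, k⟩ := order hab
  obtain ⟨c₁, d₁, hcd₁, e₁, l₁, k₁⟩ := order hcd
  obtain ⟨c₂, d₂, hcd₂, e₂, l₂, k₂⟩ := order hcd'
  rw [← e, ← e₁] at hne
  rw [← e, ← e₂] at hne'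
  rw [← e₁, ← e₂]
  obtain ⟨rfl, rfl⟩ := h a₁ b₁ c₁ d₁ c₂ d₂ hab₁ hcd₁ hcd₂
    ((k₁.2 (k.1 hx)).alternate hpos l l₁ hne) ((k₂.2 (k.1 hx')).alternate hpos l l₂ hne')
  rfl

/-! ### Copies of the pictures -/

section Copies

variable {V : Type*} [Fintype V] {G : SimpleGraph V} [DecidableRel G.Adj]

/-- The fields of the picture are arguments here, so that `f` and `d` can be given on an explicit
`Fin n`; `d` lists the degrees in the picture.  The bound for the hollow vertices follows from the edges
of the copy. -/
theorem isCopy_mk {n : ℕ} {E : Finset (Sym2 (Fin n))} {S M : Finset (Fin n)} {H : Fin n → ℕ}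
    {f : Fin n → V} (d : Fin n → ℕ)
    (hd : ∀ i, (E.filter (fun e => i ∈ e)).card + H i = d i) (hH : ∀ i, i ∉ S → H i = 0)
    (hf : Function.Injective f) (hE : ∀ e ∈ E, e.map f ∈ G.edgeSet)
    (hS : ∀ i ∈ S, G.degree (f i) = d i) (hM : ∀ i ∈ M, G.degree (f i) ≤ 7) :
    IsCopy G ⟨n, E, S, M, H⟩ f := by
  have adj : ∀ i j, s(i, j) ∈ E → G.Adj (f i) (f j) := fun i j h => by
    simpa using hE _ h
  refine ⟨hf, adj, fun i hi => (hS i hi).trans (hd i).symm, fun i hi => ?_, hM⟩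
  classical
  change (E.filter (fun e => i ∈ e)).card + H i ≤ _
  rw [hH i hi, add_zero]
  calc (E.filter (fun e => i ∈ e)).card
      ≤ ((Finset.univ.filter (fun j => s(i, j) ∈ E)).image (fun j => s(i, j))).card := by
        apply Finset.card_le_card
        intro e he
        obtain ⟨he, j, rfl⟩ := Finset.mem_filter.1 he
        exact Finset.mem_image.2 ⟨j, by simpa using he, rfl⟩
    _ ≤ (Finset.univ.filter (fun j => s(i, j) ∈ E)).card := Finset.card_image_le
    _ = ((Finset.univ.filter (fun j => s(i, j) ∈ E)).image f).card :=
        (Finset.card_image_of_injective _ hf).symm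
    _ ≤ (G.neighborFinset (f i)).card := by
        apply Finset.card_le_card
        intro v hv
        obtain ⟨j, hj, rfl⟩ := Finset.mem_image.1 hv
        rw [SimpleGraph.mem_neighborFinset]
        exact adj i j (Finset.mem_filter.1 hj).2
    _ = G.degree (f i) := rfl

end Copies

/-! ### Graphs on a line -/

/-- `u` is a vertex of degree `2` with the neighbours `a` and `b`. -/
def Ear {V : Type*} (G : SimpleGraph V) (a u b : V) : Prop :=
  ∀ z, G.Adj u z ↔ z = a ∨ z = b

theorem Ear.symm {V : Type*} {G : SimpleGraph V} {a u b : V} (h : Ear G a u b) : Ear G b u a :=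
  fun z => (h z).trans or_comm

/-- The opposite order on the same type. -/
abbrev reverseOrder (V : Type*) [LinearOrder V] : LinearOrder V :=
  inferInstanceAs (LinearOrder Vᵒᵈ)

section Line

variable {V : Type*} [LinearOrder V]

theorem Alternate.swap {W : Type*} {p : W → V} {a b c d : W} :
    @Alternate W V (reverseOrder V) p a b c d ↔ Alternate p b a d c := by
  unfold Alternate
  constructor <;> rintro (⟨h1, h2, h3⟩ | ⟨h1, h2, h3⟩)
  exacts [Or.inr ⟨h3, h2, h1⟩, Or.inl ⟨h3, h2, h1⟩, Or.inr ⟨h3, h2, h1⟩, Or.inl ⟨h3, h2, h1⟩]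

theorem OneCrossing.swap {W : Type*} {p : W → V} {G : SimpleGraph W} :
    @OneCrossing W V (reverseOrder V) p G ↔ OneCrossing p G := by
  unfold OneCrossing
  simp only [Alternate.swap]
  constructor <;> intro h a b c d c' d' h1 h2 h3 h4 h5 <;>
    exact (h b a d c d' c' h1.symm h2.symm h3.symm h4 h5).symm

/-- The conclusion of the theorem for a graph whose vertices are placed on a line in their order:
the pictures that are regarded as drawings occur in the order of the line, or in the opposite order,
and the graph with the additional edge is drawn after a permutation of the vertices. -/
def HasConfiguration [Fintype V] (G : SimpleGraph V) [DecidableRel G.Adj] : Prop :=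
  (∃ P ∈ [G1, G2, G4, G5], ∃ f : Fin P.size → V, IsCopy G P f) ∨
  (∃ f : Fin 4 → V, IsCopy G G3 f ∧
    ∃ σ : Equiv.Perm V, OneCrossing σ (G ⊔ SimpleGraph.edge (f 1) (f 2))) ∨
  (∃ P ∈ [G6, G7, G8, G9, G10, G11, G12, G13, G14, G15, G16, G17],
    ∃ f : Fin P.size → V, IsCopy G P f ∧ (StrictMono f ∨ StrictAnti f))

/-- No edge joins a vertex strictly between `a` and `b` to a vertex outside the interval. -/
def Isolated (G : SimpleGraph V) (a b : V) : Prop :=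
  ∀ x y, a < x → x < b → G.Adj x y → a ≤ y ∧ y ≤ b

/-- There is no vertex between `a` and `b`, or only one, of degree `2` with neighbours `a`, `b`. -/
def Short (G : SimpleGraph V) (a b : V) : Prop :=
  a ⋖ b ∨ ∃ u, a ⋖ u ∧ u ⋖ b ∧ Ear G a u b

/-- The interval from `a` to `b` is spanned by the crossing edges `ay`, `xb`; its first and last
steps are edges, and between `x` and `y` it is short.  These intervals contain `G3`, `G6`, `G7` or
`G12`, up to the bound on the degree of an end. -/
def Tight (G : SimpleGraph V) (a b : V) : Prop :=
  ∃ x y, a ⋖ x ∧ y ⋖ b ∧ Short G x y ∧ G.Adj a x ∧ G.Adj a y ∧ G.Adj x b ∧ G.Adj y b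

theorem covBy_swap {a b : V} : @CovBy V (reverseOrder V).toLT a b ↔ b ⋖ a :=
  ⟨fun h => ⟨h.1, fun _ h1 h2 => h.2 h2 h1⟩, fun h => ⟨h.1, fun _ h1 h2 => h.2 h2 h1⟩⟩

theorem Isolated.swap {G : SimpleGraph V} {a b : V} (h : Isolated G a b) :
    @Isolated V (reverseOrder V) G b a :=
  fun x y h1 h2 h3 => (h x y h2 h1 h3).symm

theorem Short.swap {G : SimpleGraph V} {a b : V} (h : Short G a b) :
    @Short V (reverseOrder V) G b a := by
  rcases h with h | ⟨u, h1, h2, h3⟩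
  · exact Or.inl (covBy_swap.2 h)
  · exact Or.inr ⟨u, covBy_swap.2 h2, covBy_swap.2 h1, h3.symm⟩

theorem Tight.swap {G : SimpleGraph V} {a b : V} (h : Tight G a b) :
    @Tight V (reverseOrder V) G b a := by
  obtain ⟨x, y, h1, h2, h3, h4, h5, h6, h7⟩ := h
  exact ⟨y, x, covBy_swap.2 h2, covBy_swap.2 h1, h3.swap, h7.symm, h6.symm, h5.symm, h4.symm⟩

theorem HasConfiguration.of_swap [Fintype V] {G : SimpleGraph V} [DecidableRel G.Adj]
    (h : @HasConfiguration V (reverseOrder V) _ G _) : HasConfiguration G := by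
  rcases h with h | ⟨f, h, σ, hσ⟩ | ⟨P, hP, f, h, hf | hf⟩
  · exact Or.inl h
  · exact Or.inr (Or.inl ⟨f, h, σ, OneCrossing.swap.1 hσ⟩)
  · exact Or.inr (Or.inr ⟨P, hP, f, h, Or.inr hf⟩)
  · exact Or.inr (Or.inr ⟨P, hP, f, h, Or.inl hf⟩)

/-! ### Decomposition of isolated intervals -/

/-- If `ay` and `xb` cross, with `a < x < y < b`, then no other edge crosses them, so that each of the
three intervals between consecutive ends is isolated. -/
theorem OneCrossing.isolated {G : SimpleGraph V} (h : OneCrossing id G) {a x y b : V}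
    (hax : a < x) (hxy : x < y) (hyb : y < b) (hay : G.Adj a y) (hxb : G.Adj x b) :
    Isolated G a x ∧ Isolated G x y ∧ Isolated G y b ∧ Isolated G a b := by
  have h1 : ∀ s t, G.Adj s t → Alternate id a y s t → s = x ∧ t = b := fun s t hst hA =>
    h a y s t x b hay hst hxb hA (Or.inl ⟨hax, hxy, hyb⟩)
  have h2 : ∀ s t, G.Adj s t → Alternate id x b s t → s = a ∧ t = y := fun s t hst hA =>
    h x b s t a y hxb hst hay hA (Or.inr ⟨hax, hxy, hyb⟩)
  simp only [Alternate, id] at h1 h2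
  have main : ∀ s t, G.Adj s t → (a < s ∧ s < x → a ≤ t ∧ t ≤ x) ∧
      (x < s ∧ s < y → x ≤ t ∧ t ≤ y) ∧ (y < s ∧ s < b → y ≤ t ∧ t ≤ b) ∧
      (a < s ∧ s < b → a ≤ t ∧ t ≤ b) := by
    intro s t hst
    have e1 := h1 s t hst
    have e2 := h1 t s hst.symm
    have e3 := h2 s t hst
    have e4 := h2 t s hst.symm
    clear h h1 h2
    have := lt_trichotomy t a
    have := lt_trichotomy t x
    have := lt_trichotomy t y
    have := lt_trichotomy t b
    have := lt_trichotomy s x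
    have := lt_trichotomy s y
    grind
  exact ⟨fun s t p q r => (main s t r).1 ⟨p, q⟩, fun s t p q r => (main s t r).2.1 ⟨p, q⟩,
    fun s t p q r => (main s t r).2.2.1 ⟨p, q⟩, fun s t p q r => (main s t r).2.2.2 ⟨p, q⟩⟩

/-- An isolated interval is a single step, or it splits at a vertex that is covered by no edge but
possibly the edge between the ends, or it is spanned by two crossing edges. -/
theorem OneCrossing.decompose [Fintype V] {G : SimpleGraph V} (h : OneCrossing id G) {a b : V}
    (hab : a < b) (hiso : Isolated G a b) :
    a ⋖ b ∨ (∃ c, a < c ∧ c < b ∧ Isolated G a c ∧ Isolated G c b) ∨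
    ∃ x y, a < x ∧ x < y ∧ y < b ∧ G.Adj a y ∧ G.Adj x b ∧
      Isolated G a x ∧ Isolated G x y ∧ Isolated G y b := by
  classical
  by_cases hcov : a ⋖ b
  · exact Or.inl hcov
  right
  rw [or_iff_not_imp_left]
  intro hsplit
  have cover : ∀ c, a < c → c < b →
      ∃ x z, G.Adj x z ∧ a ≤ x ∧ x < c ∧ c < z ∧ z ≤ b ∧ ¬ (x = a ∧ z = b) := by
    intro c hac hcb
    by_contra hno
    push Not at hno
    refine hsplit ⟨c, hac, hcb, fun x y h1 h2 h3 => ?_, fun x y h1 h2 h3 => ?_⟩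
    · have := hiso x y h1 (h2.trans hcb) h3
      refine ⟨this.1, not_lt.1 fun h4 => ?_⟩
      exact h1.ne' (hno x y h3 h1.le h2 h4 this.2).1
    · have := hiso x y (hac.trans h1) h2 h3
      refine ⟨not_lt.1 fun h4 => ?_, this.2⟩
      exact h2.ne (hno y x h3.symm this.1 h4 h1 h2.le).2
  -- The next vertex `m` after the left end is covered by an edge from the left end.  The longest such
  -- edge is one edge of the pair, and an edge that covers its right end is the other one.
  obtain ⟨m, hm⟩ : ∃ m, m ∈ Finset.univ.filter (fun m => a < m ∧ m < b) := by
    rw [not_covBy_iff hab] at hcov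
    obtain ⟨c, h1, h2⟩ := hcov
    exact ⟨c, by simp [h1, h2]⟩
  obtain ⟨m, hm, hmin⟩ := Finset.exists_min_image _ id ⟨m, hm⟩
  simp only [Finset.mem_filter, Finset.mem_univ, true_and, id, and_imp] at hm hmin
  obtain ⟨x₀, z₀, hadj, h1, h2, h3, h4, h5⟩ := cover m hm.1 hm.2
  obtain rfl : x₀ = a := by
    by_contra hne
    exact absurd (hmin x₀ (lt_of_le_of_ne h1 (Ne.symm hne)) (h2.trans hm.2)) (not_le.2 h2)
  have hz₀ : z₀ ∈ Finset.univ.filter (fun y => x₀ < y ∧ y < b ∧ G.Adj x₀ y) := by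
    have : z₀ ≠ b := fun e => h5 ⟨rfl, e⟩
    simp [hadj, h2.trans h3, lt_of_le_of_ne h4 this]
  obtain ⟨y, hy, hmax⟩ := Finset.exists_max_image _ id ⟨z₀, hz₀⟩
  simp only [Finset.mem_filter, Finset.mem_univ, true_and, id, and_imp] at hy hmax
  obtain ⟨x, z, hxz, k1, k2, k3, k4, k5⟩ := cover y hy.1 hy.2.1
  have hx : x₀ < x := by
    refine lt_of_le_of_ne k1 fun e => ?_
    subst e
    have : z ≠ b := fun e => k5 ⟨rfl, e⟩
    exact absurd (hmax z (k2.trans k3) (lt_of_le_of_ne k4 this) hxz) (not_le.2 k3)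
  obtain ⟨i1, i2, i3, i4⟩ := h.isolated hx k2 k3 hy.2.2 hxz
  have hz : z = b := by
    by_contra hne
    obtain ⟨s, t, hst, l1, l2, l3, l4, l5⟩ := cover z (hx.trans (k2.trans k3))
      (lt_of_le_of_ne k4 hne)
    rcases eq_or_lt_of_le l1 with rfl | l1
    · have : t ≠ b := fun e => l5 ⟨rfl, e⟩
      exact absurd (hmax t (l2.trans l3) (lt_of_le_of_ne l4 this) hst)
        (not_le.2 (k3.trans l3))
    · exact absurd (i4 s t l1 l2 hst).2 (not_le.2 l3)
  subst hz
  exact ⟨x, y, hx, k2, k3, hy.2.2, hxz, i1, i2, i3⟩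

/-! ### Adding the edge between two twins -/

/-- An edge between neighbours on the line crosses nothing. -/
theorem OneCrossing.sup_edge {G : SimpleGraph V} (h : OneCrossing id G) {x y : V} (hxy : x ⋖ y) :
    OneCrossing (Equiv.refl V) (G ⊔ SimpleGraph.edge x y) := by
  have lt := hxy.lt
  have no : ∀ z, ¬ (x < z ∧ z < y) := fun z hz => hxy.2 hz.1 hz.2
  have key : ∀ a b c d, (G ⊔ SimpleGraph.edge x y).Adj a b → (G ⊔ SimpleGraph.edge x y).Adj c d →
      Alternate (Equiv.refl V) a b c d → G.Adj a b ∧ G.Adj c d := by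
    intro a b c d h1 h2 h3
    simp only [SimpleGraph.sup_adj, SimpleGraph.edge_adj] at h1 h2
    simp only [Alternate, Equiv.refl_apply] at h3
    grind
  intro a b c d c' d' h1 h2 h3 h4 h5
  exact h a b c d c' d' (key _ _ _ _ h1 h2 h4).1 (key _ _ _ _ h1 h2 h4).2 (key _ _ _ _ h1 h3 h5).2
    h4 h5

set_option maxHeartbeats 1000000 in
/-- The vertices `u` and `y` both have the neighbours `a` and `x` only, but the edge `xb` separates
them in the order `a, u, x, y, b`.  In the order `a, u, y, x, b` they are neighbours on the line, and
the only crossing in the interval is that of `ux` and `ay`. -/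
theorem OneCrossing.sup_edge_swap {G : SimpleGraph V} (h : OneCrossing id G) {a u x y b : V}
    (hau : a ⋖ u) (hux : u ⋖ x) (hxy : x ⋖ y) (hyb : y ⋖ b) (hu : Ear G a u x) (hy : Ear G a y x)
    (hx : ∀ z, G.Adj x z → z = a ∨ z = u ∨ z = y ∨ z = b) :
    OneCrossing (Equiv.swap x y) (G ⊔ SimpleGraph.edge u y) := by
  have ne := hxy.lt.ne
  set p : V → V := ⇑(Equiv.swap x y) with hp
  have px : p x = y := Equiv.swap_apply_left _ _
  have py : p y = x := Equiv.swap_apply_right _ _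
  have pz : ∀ z, z ≠ x → z ≠ y → p z = z := fun z => Equiv.swap_apply_of_ne_of_ne
  have pu : p u = u := pz u hux.lt.ne (hux.lt.trans hxy.lt).ne
  have pa : p a = a := pz a (hau.lt.trans hux.lt).ne (hau.lt.trans (hux.lt.trans hxy.lt)).ne
  have pb : p b = b := pz b (hxy.lt.trans hyb.lt).ne' hyb.lt.ne'
  have l1 := hau.lt
  have l2 := hux.lt
  have l3 := hxy.lt
  have l4 := hyb.lt
  have out : ∀ z, z ≠ u → z ≠ x → z ≠ y → p z = z ∧ (z ≤ a ∨ b ≤ z) := by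
    intro z h1 h2 h3
    refine ⟨pz z h2 h3, ?_⟩
    rcases le_or_gt z a with h4 | h4
    · exact Or.inl h4
    have h5 := lt_of_le_of_ne (hau.ge_of_gt h4) (Ne.symm h1)
    have h6 := lt_of_le_of_ne (hux.ge_of_gt h5) (Ne.symm h2)
    have h7 := lt_of_le_of_ne (hxy.ge_of_gt h6) (Ne.symm h3)
    exact Or.inr (hyb.ge_of_gt h7)
  -- The edges, from left to right in the new order: the first kind lies outside the interval or
  -- passes above it, and its ends have not moved.
  have edges : ∀ s t, (G ⊔ SimpleGraph.edge u y).Adj s t → p s < p t →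
      (G.Adj s t ∧ (p s = s ∧ (s ≤ a ∨ b ≤ s)) ∧ (p t = t ∧ (t ≤ a ∨ b ≤ t))) ∨
      (s = a ∧ t = u) ∨ (s = u ∧ t = x) ∨ (s = u ∧ t = y) ∨ (s = a ∧ t = y) ∨ (s = y ∧ t = x) ∨
      (s = x ∧ t = b) ∨ (s = a ∧ t = x) := by
    intro s t hst hlt
    have hst' : (s = u ∧ t = y ∨ s = y ∧ t = u) ∨ G.Adj s t := by
      simp only [SimpleGraph.sup_adj, SimpleGraph.edge_adj] at hst
      tauto
    rcases hst' with (⟨rfl, rfl⟩ | ⟨rfl, rfl⟩) | hst'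
    · simp
    · rw [py, pu] at hlt; exact absurd hlt (lt_asymm l2)
    have e1 := hu t
    have e2 := hy t
    have e3 := hx t
    have e4 := hu s
    have e5 := hy s
    have e6 := hx s
    have o1 := out s
    have o2 := out t
    have := hst'.symm
    have := hst'.ne
    by_cases s = u
    · grind
    by_cases s = x
    · grind
    by_cases s = y
    · grind
    by_cases t = u
    · grind
    by_cases t = x
    · grind
    by_cases t = y
    · grind
    grind
  -- If the first edge starts further left, then the edges are `ay` and `ux`, or both of them avoid
  -- `u`, `x` and `y` and cross in the old order.
  have first_left : ∀ s t s' t', (G ⊔ SimpleGraph.edge u y).Adj s t →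
      (G ⊔ SimpleGraph.edge u y).Adj s' t' → p s < p s' → p s' < p t → p t < p t' →
      (s = a ∧ t = y ∧ s' = u ∧ t' = x) ∨ (G.Adj s t ∧ G.Adj s' t' ∧ (s < s' ∧ s' < t ∧ t < t') ∧
        (t ≤ a ∨ b ≤ t) ∧ (t' ≤ a ∨ b ≤ t')) := by
    intro s t s' t' h1 h2 h3 h4 h5
    have e1 := edges s t h1 (h3.trans h4)
    have e2 := edges s' t' h2 (h4.trans h5)
    clear edges out pz h1 h2 hx hu hy h
    clear_value p
    clear hp
    rcases e1 with ⟨g, ⟨f1, f2⟩, f3, f4⟩ | ⟨rfl, rfl⟩ | ⟨rfl, rfl⟩ | ⟨rfl, rfl⟩ | ⟨rfl, rfl⟩ |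
        ⟨rfl, rfl⟩ | ⟨rfl, rfl⟩ | ⟨rfl, rfl⟩ <;>
    rcases e2 with ⟨g', ⟨f1', f2'⟩, f3', f4'⟩ | ⟨rfl, rfl⟩ | ⟨rfl, rfl⟩ | ⟨rfl, rfl⟩ | ⟨rfl, rfl⟩ |
        ⟨rfl, rfl⟩ | ⟨rfl, rfl⟩ | ⟨rfl, rfl⟩ <;>
    first
    | (simp only [px, py, pu, pa, pb] at h3 h4 h5
       first
       | exact Or.inl ⟨rfl, rfl, rfl, rfl⟩
       | (exfalso; order))
    | (rw [f1, f1'] at h3; rw [f1', f3] at h4; rw [f3, f3'] at h5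
       exact Or.inr ⟨g, g', ⟨h3, h4, h5⟩, f4, f4'⟩)
    | (exfalso
       simp only [px, py, pu, pa, pb, f1, f3] at h3 h4 h5
       rcases f2 with f2 | f2 <;> rcases f4 with f4 | f4 <;> order)
    | (exfalso
       simp only [px, py, pu, pa, pb, f1', f3'] at h3 h4 h5
       rcases f2' with f2' | f2' <;> rcases f4' with f4' | f4' <;> order)
  have key : ∀ s t s' t', (G ⊔ SimpleGraph.edge u y).Adj s t →
      (G ⊔ SimpleGraph.edge u y).Adj s' t' → Alternate p s t s' t' →
      (s = a ∧ t = y ∧ s' = u ∧ t' = x) ∨ (s = u ∧ t = x ∧ s' = a ∧ t' = y) ∨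
      (G.Adj s t ∧ G.Adj s' t' ∧ Alternate id s t s' t' ∧ t ≠ x ∧ t ≠ y) := by
    have far : ∀ t, t ≤ a ∨ b ≤ t → t ≠ x ∧ t ≠ y := by
      rintro t (h | h) <;> constructor <;> rintro rfl <;> order
    rintro s t s' t' h1 h2 (⟨h3, h4, h5⟩ | ⟨h3, h4, h5⟩)
    · rcases first_left _ _ _ _ h1 h2 h3 h4 h5 with k | ⟨k1, k2, k3, k4, k5⟩
      · exact Or.inl k
      · exact Or.inr (Or.inr ⟨k1, k2, Or.inl k3, far t k4⟩)
    · rcases first_left _ _ _ _ h2 h1 h3 h4 h5 with ⟨k1, k2, k3, k4⟩ | ⟨k1, k2, k3, k4, k5⟩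
      · exact Or.inr (Or.inl ⟨k3, k4, k1, k2⟩)
      · exact Or.inr (Or.inr ⟨k2, k1, Or.inr k3, far t k5⟩)
  intro s t c d c' d' h1 h2 h3 h4 h5
  rcases key _ _ _ _ h1 h2 h4 with ⟨k1, k2, k3, k4⟩ | ⟨k1, k2, k3, k4⟩ | ⟨k1, k2, k3, k4⟩ <;>
    rcases key _ _ _ _ h1 h3 h5 with ⟨l1', l2', l3', l4'⟩ | ⟨l1', l2', l3', l4'⟩ |
      ⟨l1', l2', l3', l4'⟩
  · exact ⟨k3.trans l3'.symm, k4.trans l4'.symm⟩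
  · exact absurd (k2.symm.trans l2') ne.symm
  · exact absurd k2 l4'.2
  · exact absurd (l2'.symm.trans k2) ne.symm
  · exact ⟨k3.trans l3'.symm, k4.trans l4'.symm⟩
  · exact absurd k2 l4'.1
  · exact absurd l2' k4.2
  · exact absurd l2' k4.1
  · exact h s t c d c' d' k1 k2 l2' k3 l3'

end Line

/-! ### Recognizing configurations on the line -/

section Recognize

variable {V : Type*} [LinearOrder V]

/-- A chain of covering steps that starts at or below `z` contains `z` or stays below it. -/
theorem mem_or_lt_of_isChain_covBy {z : V} : ∀ {l : List V} {a : V},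
    List.IsChain (· ⋖ ·) (a :: l) → a ≤ z → z ∈ a :: l ∨ ∀ y ∈ a :: l, y < z
  | [], a, _, h => by
    rcases h.eq_or_lt with h | h
    · simp [h]
    · simp [h]
  | b :: l, a, hl, h => by
    rw [List.isChain_cons_cons] at hl
    rcases h.eq_or_lt with h | h
    · simp [h]
    · rcases mem_or_lt_of_isChain_covBy hl.2 (hl.1.ge_of_gt h) with k | k
      · exact Or.inl (List.mem_cons_of_mem _ k)
      · right
        intro y hy
        rcases List.mem_cons.1 hy with rfl | hy
        · exact h
        · exact k y hy

/-- The vertices of an isolated interval, listed in order, contain the neighbours of its inner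
vertices. -/
theorem Isolated.mem_of_adj {G : SimpleGraph V} {a b : V} (h : Isolated G a b) {l : List V}
    (hl : List.IsChain (· ⋖ ·) (a :: l)) (hb : b ∈ a :: l) {x z : V} (hax : a < x) (hxb : x < b)
    (hxz : G.Adj x z) : z ∈ a :: l := by
  obtain ⟨h1, h2⟩ := h x z hax hxb hxz
  exact (mem_or_lt_of_isChain_covBy hl h1).resolve_right fun k => (k b hb).not_ge h2

variable [Fintype V] {G : SimpleGraph V} [DecidableRel G.Adj]

theorem degree_eq_length {v : V} (l : List V) (hl : l.IsChain (· < ·))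
    (h : ∀ z, G.Adj v z ↔ z ∈ l) : G.degree v = l.length := by
  have hnd : l.Nodup := (List.isChain_iff_pairwise.1 hl).imp (fun h => h.ne)
  rw [← List.toFinset_card_of_nodup hnd, SimpleGraph.degree]
  congr 1
  ext z
  simp [h]

theorem degree_le_length {v : V} (l : List V) (h : ∀ z, G.Adj v z → z ∈ l) :
    G.degree v ≤ l.length := by
  refine le_trans (Finset.card_le_card (t := l.toFinset) ?_) (List.toFinset_card_le l)
  intro z hz
  simpa using h z (by simpa using hz)

theorem Ear.degree {a u x : V} (h : Ear G a u x) (hau : a < u) (hux : u < x) :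
    G.degree u = 2 :=
  degree_eq_length [a, x] (by simp [hau.trans hux]) (fun z => by simp [h z])

theorem HasConfiguration.of_G1 {u v : V} (h : G.Adj u v) (hu : G.degree u = 2)
    (hv : G.degree v = 2) : HasConfiguration G := by
  refine Or.inl ⟨G1, by simp, ![u, v], isCopy_mk ![2, 2] (by decide) (by decide) ?_ ?_ ?_ ?_⟩
  · intro i j hij
    have := h.ne
    fin_cases i <;> fin_cases j <;> simp_all
  · simp [h]
  · simp; exact ⟨hu, hv⟩
  · simp

theorem HasConfiguration.of_G2 {u v w : V} (h : G.Adj u v) (huw : G.Adj u w) (hvw : G.Adj v w)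
    (hu : G.degree u = 2) (hv : G.degree v = 3) : HasConfiguration G := by
  refine Or.inl ⟨G2, by simp, ![u, v, w],
    isCopy_mk ![2, 3, 2] (by decide) (by decide) ?_ ?_ ?_ ?_⟩
  · intro i j hij
    have := h.ne
    have := huw.ne
    have := hvw.ne
    fin_cases i <;> fin_cases j <;> simp_all
  · simp [h, huw, hvw]
  · simp; exact ⟨hu, hv⟩
  · simp

theorem HasConfiguration.of_G3 {x u v y : V} (hnd : [x, u, v, y].Nodup)
    (hxu : G.Adj x u) (hxv : G.Adj x v) (huy : G.Adj u y)
    (hvy : G.Adj v y) (hu : G.degree u = 2) (hv : G.degree v = 2) (hy : G.degree y ≤ 7)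
    {σ : Equiv.Perm V} (hσ : OneCrossing σ (G ⊔ SimpleGraph.edge u v)) :
    HasConfiguration G := by
  refine Or.inr (Or.inl ⟨![x, u, v, y],
    isCopy_mk ![2, 2, 2, 2] (by decide) (by decide) ?_ ?_ ?_ ?_, σ, hσ⟩)
  · exact List.nodup_ofFn.1 (by simpa [List.ofFn_succ] using hnd)
  · simp [hxu, hxv, huy, hvy]
  · simp; exact ⟨hu, hv⟩
  · simp; exact hy

theorem HasConfiguration.of_G4 {a u b w c : V} (hnd : [a, u, b, w, c].Nodup)
    (hau : G.Adj a u) (hub : G.Adj u b) (hab : G.Adj a b) (hbw : G.Adj b w) (hwc : G.Adj w c)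
    (hbc : G.Adj b c) (hu : G.degree u = 2) (hb : G.degree b = 4) (hw : G.degree w = 2) :
    HasConfiguration G := by
  refine Or.inl ⟨G4, by simp, ![a, u, b, w, c],
    isCopy_mk ![2, 2, 4, 2, 2] (by decide) (by decide) ?_ ?_ ?_ ?_⟩
  · exact List.nodup_ofFn.1 (by simpa [List.ofFn_succ] using hnd)
  · simp [hau, hub, hab, hbw, hwc, hbc]
  · simp; exact ⟨hu, hb, hw⟩
  · simp

theorem HasConfiguration.of_G5 {a u b w c d : V} (hnd : [a, u, b, w, c, d].Nodup)
    (hau : G.Adj a u) (hub : G.Adj u b) (hab : G.Adj a b) (hbw : G.Adj b w) (hwc : G.Adj w c)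
    (hbd : G.Adj b d) (hu : G.degree u = 2) (hb : G.degree b = 4) (hw : G.degree w = 2) :
    HasConfiguration G := by
  refine Or.inl ⟨G5, by simp, ![a, u, b, w, c, d],
    isCopy_mk ![2, 2, 4, 2, 1, 1] (by decide) (by decide) ?_ ?_ ?_ ?_⟩
  · exact List.nodup_ofFn.1 (by simpa [List.ofFn_succ] using hnd)
  · simp [hau, hub, hab, hbw, hwc, hbd]
  · simp; exact ⟨hu, hb, hw⟩
  · simp

/-- Recognition of the pictures that are regarded as drawings: `f` lists the vertices from left to
right, and `d` lists the degrees in the picture. -/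
theorem HasConfiguration.of_strictMono {n : ℕ} {E : Finset (Sym2 (Fin n))}
    {S M : Finset (Fin n)} {H : Fin n → ℕ} (f : Fin n → V) (d : Fin n → ℕ)
    (hP : Picture.mk n E S M H ∈ [G6, G7, G8, G9, G10, G11, G12, G13, G14, G15, G16, G17])
    (hd : ∀ i, (E.filter (fun e => i ∈ e)).card + H i = d i) (hH : ∀ i, i ∉ S → H i = 0)
    (hf : StrictMono f) (hE : ∀ e ∈ E, e.map f ∈ G.edgeSet)
    (hS : ∀ i ∈ S, G.degree (f i) = d i) (hM : ∀ i ∈ M, G.degree (f i) ≤ 7) :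
    HasConfiguration G :=
  Or.inr (Or.inr ⟨_, hP, f, isCopy_mk d hd hH hf.injective hE hS hM, Or.inl hf⟩)

/-- The mirror image of `of_strictMono`: `f` lists the vertices from right to left. -/
theorem HasConfiguration.of_strictAnti {n : ℕ} {E : Finset (Sym2 (Fin n))}
    {S M : Finset (Fin n)} {H : Fin n → ℕ} (f : Fin n → V) (d : Fin n → ℕ)
    (hP : Picture.mk n E S M H ∈ [G6, G7, G8, G9, G10, G11, G12, G13, G14, G15, G16, G17])
    (hd : ∀ i, (E.filter (fun e => i ∈ e)).card + H i = d i) (hH : ∀ i, i ∉ S → H i = 0)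
    (hf : StrictAnti f) (hE : ∀ e ∈ E, e.map f ∈ G.edgeSet)
    (hS : ∀ i ∈ S, G.degree (f i) = d i) (hM : ∀ i ∈ M, G.degree (f i) ≤ 7) :
    HasConfiguration G :=
  Or.inr (Or.inr ⟨_, hP, f, isCopy_mk d hd hH hf.injective hE hS hM, Or.inr hf⟩)

end Recognize

/-! ### Tight intervals -/

section Tight

variable {V : Type*} [LinearOrder V] [Fintype V] {G : SimpleGraph V} [DecidableRel G.Adj]

theorem Tight.hasConfiguration_right (h1 : OneCrossing id G) {a b : V} (h : Tight G a b)
    (hiso : Isolated G a b) (hb : G.degree b ≤ 7) : HasConfiguration G := by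
  have sym : ∀ s t, G.Adj s t → G.Adj t s := fun s t h => h.symm
  have irr : ∀ s, ¬ G.Adj s s := fun s => G.loopless.irrefl s
  obtain ⟨x, y, hax, hyb, hxy | ⟨w, hxw, hwy, hw⟩, hax', hay', hxb', hyb'⟩ := h
  · have l1 := hax.lt
    have l2 := hxy.lt
    have l3 := hyb.lt
    have hch : List.IsChain (· ⋖ ·) [a, x, y, b] := by simp [hax, hxy, hyb]
    have hx := fun z => hiso.mem_of_adj hch (by simp) (x := x) (z := z) (by order) (by order)
    have hy := fun z => hiso.mem_of_adj hch (by simp) (x := y) (z := z) (by order) (by order)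
    by_cases q : G.Adj x y
    · have dx : G.degree x = 3 := degree_eq_length [a, y, b] (by simp; grind) (by grind)
      have dy : G.degree y = 3 := degree_eq_length [a, x, b] (by simp; grind) (by grind)
      refine .of_strictMono ![a, x, y, b] ![2, 3, 3, 2] (show G6 ∈ _ by simp) (by decide) (by decide)
        ?_ ?_ ?_ ?_
      · simp [strictMono_vecCons, l1, l2, l3]
      · simp [*]
      · simp; exact ⟨dx, dy⟩
      · simp; exact hb
    · have dx : G.degree x = 2 := degree_eq_length [a, b] (by simp; grind) (by grind)
      have dy : G.degree y = 2 := degree_eq_length [a, b] (by simp; grind) (by grind)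
      exact .of_G3 (by simp; grind) hax' hay' hxb' hyb' dx dy hb (h1.sup_edge hxy)
  · have l1 := hax.lt
    have l2 := hxw.lt
    have l3 := hwy.lt
    have l4 := hyb.lt
    have hch : List.IsChain (· ⋖ ·) [a, x, w, y, b] := by simp [hax, hxw, hwy, hyb]
    have hx := fun z => hiso.mem_of_adj hch (by simp) (x := x) (z := z) (by order) (by order)
    have hy := fun z => hiso.mem_of_adj hch (by simp) (x := y) (z := z) (by order) (by order)
    have dw := hw.degree l2 l3
    unfold Ear at hw
    by_cases q : G.Adj x y
    · have dx : G.degree x = 4 := degree_eq_length [a, w, y, b] (by simp; grind) (by grind)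
      have dy : G.degree y = 4 := degree_eq_length [a, x, w, b] (by simp; grind) (by grind)
      refine .of_strictMono ![a, x, w, y, b] ![2, 4, 2, 4, 2] (show G12 ∈ _ by simp) (by decide) (by decide)
        ?_ ?_ ?_ ?_
      · simp [strictMono_vecCons, l1, l2, l3, l4]
      · simp [*]
      · simp; exact ⟨dx, dw, dy⟩
      · simp; exact hb
    · have dx : G.degree x = 3 := degree_eq_length [a, w, b] (by simp; grind) (by grind)
      have dy : G.degree y = 3 := degree_eq_length [a, w, b] (by simp; grind) (by grind)
      refine .of_strictMono ![a, x, w, y, b] ![2, 3, 2, 3, 2] (show G7 ∈ _ by simp) (by decide) (by decide)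
        ?_ ?_ ?_ ?_
      · simp [strictMono_vecCons, l1, l2, l3, l4]
      · simp [*]
      · simp; exact ⟨dx, dw, dy⟩
      · simp; exact hb

theorem Tight.hasConfiguration_left (h1 : OneCrossing id G) {a b : V} (h : Tight G a b)
    (hiso : Isolated G a b) (ha : G.degree a ≤ 7) : HasConfiguration G :=
  .of_swap (@Tight.hasConfiguration_right V (reverseOrder V) _ G _ (OneCrossing.swap.2 h1) b a
    h.swap hiso.swap ha)

end Tight

/-! ### Intervals spanned by a crossing pair of edges -/

section CrossingPair

variable {V : Type*} [LinearOrder V] [Fintype V] {G : SimpleGraph V} [DecidableRel G.Adj]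

/-- The six lemmas `crossing_*` treat an isolated interval from `a` to `b` that is spanned by the
crossing edges `ay` and `xb`; the three numbers in the name count the vertices strictly inside the
short parts `ax`, `xy`, `yb`, and `u`, `w`, `v` denote these inner vertices.  All the edges are then
known, except for `ax`, `xy`, `yb`, which leaves at most eight graphs in each lemma. -/
theorem crossing_zero_zero_zero (hδ : ∀ v, 2 ≤ G.degree v) {a x y b : V}
    (hiso : Isolated G a b) (hax : a ⋖ x) (hxy : x ⋖ y) (hyb : y ⋖ b)
   
    (hay : G.Adj a y) (hxb : G.Adj x b) :
    HasConfiguration G ∨ Tight G a b := by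
  have sym : ∀ s t, G.Adj s t → G.Adj t s := fun s t h => h.symm
  have irr : ∀ s, ¬ G.Adj s s := fun s => G.loopless.irrefl s
  have l1 := hax.lt
  have l2 := hxy.lt
  have l3 := hyb.lt
  have hch : List.IsChain (· ⋖ ·) [a, x, y, b] := by simp [*]
  have hx := fun z => hiso.mem_of_adj hch (by simp) (x := x) (z := z) (by order) (by order)
  have hy := fun z => hiso.mem_of_adj hch (by simp) (x := y) (z := z) (by order) (by order)
  by_cases p : G.Adj a x <;> by_cases r : G.Adj y b
  · exact Or.inr ⟨x, y, hax, hyb, Or.inl hxy, p, hay, hxb, r⟩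
  · by_cases q : G.Adj x y
    · left
      have dx : G.degree x = 3 := degree_eq_length [a, y, b] (by simp; grind) (by grind)
      have dy : G.degree y = 2 := degree_eq_length [a, x] (by simp; grind) (by grind)
      exact .of_G2 q.symm hay.symm p.symm dy dx
    · exfalso
      have := (hδ y).trans (degree_le_length [a] (by grind))
      simp at this
  · by_cases q : G.Adj x y
    · left
      have dx : G.degree x = 2 := degree_eq_length [y, b] (by simp; grind) (by grind)
      have dy : G.degree y = 3 := degree_eq_length [a, x, b] (by simp; grind) (by grind)
      exact .of_G2 q hxb r dx dy
    · exfalso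
      have := (hδ x).trans (degree_le_length [b] (by grind))
      simp at this
  · by_cases q : G.Adj x y
    · left
      have dx : G.degree x = 2 := degree_eq_length [y, b] (by simp; grind) (by grind)
      have dy : G.degree y = 2 := degree_eq_length [a, x] (by simp; grind) (by grind)
      exact .of_G1 q dx dy
    · exfalso
      have := (hδ x).trans (degree_le_length [b] (by grind))
      simp at this

theorem crossing_zero_one_zero {a x w y b : V}
    (hiso : Isolated G a b) (hax : a ⋖ x) (hxw : x ⋖ w) (hwy : w ⋖ y)
    (hyb : y ⋖ b)
    (hw : Ear G x w y) (hay : G.Adj a y) (hxb : G.Adj x b) :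
    HasConfiguration G ∨ Tight G a b := by
  have sym : ∀ s t, G.Adj s t → G.Adj t s := fun s t h => h.symm
  have irr : ∀ s, ¬ G.Adj s s := fun s => G.loopless.irrefl s
  have l1 := hax.lt
  have l2 := hxw.lt
  have l3 := hwy.lt
  have l4 := hyb.lt
  have hch : List.IsChain (· ⋖ ·) [a, x, w, y, b] := by simp [*]
  have hx := fun z => hiso.mem_of_adj hch (by simp) (x := x) (z := z) (by order) (by order)
  have hy := fun z => hiso.mem_of_adj hch (by simp) (x := y) (z := z) (by order) (by order)
  have hw' := hw
  have dw := hw.degree (by order) (by order)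
  unfold Ear at hw
  by_cases p : G.Adj a x
  · by_cases r : G.Adj y b
    · exact Or.inr ⟨x, y, hax, hyb, Or.inr ⟨w, hxw, hwy, hw'⟩, p, hay, hxb, r⟩
    left
    by_cases q : G.Adj x y
    · have dy : G.degree y = 3 := degree_eq_length [a, x, w] (by simp; grind) (by grind)
      exact .of_G2 (by grind) (by grind) q.symm dw dy
    · have dy : G.degree y = 2 := degree_eq_length [a, w] (by simp; grind) (by grind)
      exact .of_G1 (by grind) dw dy
  · left
    by_cases q : G.Adj x y
    · have dx : G.degree x = 3 := degree_eq_length [w, y, b] (by simp; grind) (by grind)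
      exact .of_G2 (by grind) (by grind) q dw dx
    · have dx : G.degree x = 2 := degree_eq_length [w, b] (by simp; grind) (by grind)
      exact .of_G1 (by grind) dw dx

/-- If `xy` is an edge and `yb` is not, then `u` and `y` have the same neighbours `a` and `x`, and
the configuration is `G3` with a changed drawing. -/
theorem crossing_one_zero_zero (h1 : OneCrossing id G) {a u x y b : V}
    (hiso : Isolated G a b) (hau : a ⋖ u) (hux : u ⋖ x) (hxy : x ⋖ y)
    (hyb : y ⋖ b)
    (hu : Ear G a u x) (hay : G.Adj a y) (hxb : G.Adj x b) :
    HasConfiguration G := by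
  have sym : ∀ s t, G.Adj s t → G.Adj t s := fun s t h => h.symm
  have irr : ∀ s, ¬ G.Adj s s := fun s => G.loopless.irrefl s
  have l1 := hau.lt
  have l2 := hux.lt
  have l3 := hxy.lt
  have l4 := hyb.lt
  have hch : List.IsChain (· ⋖ ·) [a, u, x, y, b] := by simp [*]
  have hx := fun z => hiso.mem_of_adj hch (by simp) (x := x) (z := z) (by order) (by order)
  have hy := fun z => hiso.mem_of_adj hch (by simp) (x := y) (z := z) (by order) (by order)
  have hu' := hu
  have du := hu.degree (by order) (by order)
  unfold Ear at hu
  by_cases q : G.Adj x y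
  · by_cases r : G.Adj y b
    · have dy : G.degree y = 3 := degree_eq_length [a, x, b] (by simp; grind) (by grind)
      by_cases p : G.Adj a x
      · have dx : G.degree x = 4 := degree_eq_length [a, u, y, b] (by simp; grind) (by grind)
        refine .of_strictAnti ![b, y, x, u, a] ![2, 3, 4, 2, 3]
          (show G13 ∈ _ by simp) (by decide) (by decide) ?_ ?_ ?_ ?_
        · simp [strictAnti_vecCons, *]
        · simp [*]
        · simp; exact ⟨dy, dx, du⟩
        · simp
      · have dx : G.degree x = 3 := degree_eq_length [u, y, b] (by simp; grind) (by grind)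
        refine .of_strictAnti ![b, y, x, u, a] ![2, 3, 3, 2, 2]
          (show G8 ∈ _ by simp) (by decide) (by decide) ?_ ?_ ?_ ?_
        · simp [strictAnti_vecCons, *]
        · simp [*]
        · simp; exact ⟨dy, dx, du⟩
        · simp
    · have dy : G.degree y = 2 := degree_eq_length [a, x] (by simp; grind) (by grind)
      have hy' : Ear G a y x := by unfold Ear; grind
      have dx : G.degree x ≤ 7 :=
        (degree_le_length [a, u, y, b] (by grind)).trans (by simp)
      exact .of_G3 (by simp; grind) (by grind) hay (by grind) q.symm du dy dx
        (h1.sup_edge_swap hau hux hxy hyb hu' hy' (by grind))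
  · by_cases p : G.Adj a x
    · have dx : G.degree x = 3 := degree_eq_length [a, u, b] (by simp; grind) (by grind)
      exact .of_G2 (by grind) (by grind) p.symm du dx
    · have dx : G.degree x = 2 := degree_eq_length [u, b] (by simp; grind) (by grind)
      exact .of_G1 (by grind) du dx

theorem crossing_one_zero_one {a u x y v b : V}
    (hiso : Isolated G a b) (hau : a ⋖ u) (hux : u ⋖ x) (hxy : x ⋖ y)
    (hyv : y ⋖ v) (hvb : v ⋖ b)
    (hu : Ear G a u x) (hv : Ear G y v b) (hay : G.Adj a y) (hxb : G.Adj x b) :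
    HasConfiguration G := by
  have sym : ∀ s t, G.Adj s t → G.Adj t s := fun s t h => h.symm
  have irr : ∀ s, ¬ G.Adj s s := fun s => G.loopless.irrefl s
  have l1 := hau.lt
  have l2 := hux.lt
  have l3 := hxy.lt
  have l4 := hyv.lt
  have l5 := hvb.lt
  have hch : List.IsChain (· ⋖ ·) [a, u, x, y, v, b] := by simp [*]
  have hx := fun z => hiso.mem_of_adj hch (by simp) (x := x) (z := z) (by order) (by order)
  have hy := fun z => hiso.mem_of_adj hch (by simp) (x := y) (z := z) (by order) (by order)
  have du := hu.degree (by order) (by order)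
  have dv := hv.degree (by order) (by order)
  unfold Ear at hu hv
  by_cases q : G.Adj x y
  · by_cases p : G.Adj a x
    · have dx : G.degree x = 4 := degree_eq_length [a, u, y, b] (by simp; grind) (by grind)
      by_cases r : G.Adj y b
      · have dy : G.degree y = 4 := degree_eq_length [a, x, v, b] (by simp; grind) (by grind)
        refine .of_strictMono ![a, u, x, y, v, b] ![3, 2, 4, 4, 2, 3]
          (show G16 ∈ _ by simp) (by decide) (by decide) ?_ ?_ ?_ ?_
        · simp [strictMono_vecCons, *]
        · simp [*]
        · simp; exact ⟨du, dx, dy, dv⟩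
        · simp
      · have dy : G.degree y = 3 := degree_eq_length [a, x, v] (by simp; grind) (by grind)
        refine .of_strictMono ![a, u, x, y, v, b] ![3, 2, 4, 3, 2, 2]
          (show G14 ∈ _ by simp) (by decide) (by decide) ?_ ?_ ?_ ?_
        · simp [strictMono_vecCons, *]
        · simp [*]
        · simp; exact ⟨du, dx, dy, dv⟩
        · simp
    · have dx : G.degree x = 3 := degree_eq_length [u, y, b] (by simp; grind) (by grind)
      by_cases r : G.Adj y b
      · have dy : G.degree y = 4 := degree_eq_length [a, x, v, b] (by simp; grind) (by grind)
        refine .of_strictAnti ![b, v, y, x, u, a] ![3, 2, 4, 3, 2, 2]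
          (show G14 ∈ _ by simp) (by decide) (by decide) ?_ ?_ ?_ ?_
        · simp [strictAnti_vecCons, *]
        · simp [*]
        · simp; exact ⟨dv, dy, dx, du⟩
        · simp
      · have dy : G.degree y = 3 := degree_eq_length [a, x, v] (by simp; grind) (by grind)
        refine .of_strictMono ![a, u, x, y, v, b] ![2, 2, 3, 3, 2, 2]
          (show G9 ∈ _ by simp) (by decide) (by decide) ?_ ?_ ?_ ?_
        · simp [strictMono_vecCons, *]
        · simp [*]
        · simp; exact ⟨du, dx, dy, dv⟩
        · simp
  · by_cases p : G.Adj a x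
    · have dx : G.degree x = 3 := degree_eq_length [a, u, b] (by simp; grind) (by grind)
      exact .of_G2 (by grind) (by grind) p.symm du dx
    · have dx : G.degree x = 2 := degree_eq_length [u, b] (by simp; grind) (by grind)
      exact .of_G1 (by grind) du dx

theorem crossing_one_one_zero {a u x w y b : V}
    (hiso : Isolated G a b) (hau : a ⋖ u) (hux : u ⋖ x) (hxw : x ⋖ w)
    (hwy : w ⋖ y) (hyb : y ⋖ b)
    (hu : Ear G a u x) (hw : Ear G x w y) (hay : G.Adj a y) (hxb : G.Adj x b) :
    HasConfiguration G := by
  have sym : ∀ s t, G.Adj s t → G.Adj t s := fun s t h => h.symm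
  have irr : ∀ s, ¬ G.Adj s s := fun s => G.loopless.irrefl s
  have l1 := hau.lt
  have l2 := hux.lt
  have l3 := hxw.lt
  have l4 := hwy.lt
  have l5 := hyb.lt
  have hch : List.IsChain (· ⋖ ·) [a, u, x, w, y, b] := by simp [*]
  have hx := fun z => hiso.mem_of_adj hch (by simp) (x := x) (z := z) (by order) (by order)
  have hy := fun z => hiso.mem_of_adj hch (by simp) (x := y) (z := z) (by order) (by order)
  have du := hu.degree (by order) (by order)
  have dw := hw.degree (by order) (by order)
  unfold Ear at hu hw
  by_cases r : G.Adj y b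
  · by_cases q : G.Adj x y
    · by_cases p : G.Adj a x
      · have dx : G.degree x = 5 := degree_eq_length [a, u, w, y, b] (by simp; grind) (by grind)
        have dy : G.degree y = 4 := degree_eq_length [a, x, w, b] (by simp; grind) (by grind)
        refine .of_strictAnti ![b, y, w, x, u, a] ![2, 4, 2, 5, 2, 3]
          (show G15 ∈ _ by simp) (by decide) (by decide) ?_ ?_ ?_ ?_
        · simp [strictAnti_vecCons, *]
        · simp [*]
        · simp; exact ⟨dy, dw, dx, du⟩
        · simp
      · have dx : G.degree x = 4 := degree_eq_length [u, w, y, b] (by simp; grind) (by grind)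
        exact .of_G5 (a := y) (c := a) (d := b) (by simp; grind (splits := 20))
          (by grind) (by grind) (by grind) (by grind) (by grind) (by grind) dw dx du
    · by_cases p : G.Adj a x
      · have dx : G.degree x = 4 := degree_eq_length [a, u, w, b] (by simp; grind) (by grind)
        exact .of_G5 (a := a) (c := y) (d := b) (by simp; grind (splits := 20))
          (by grind) (by grind) (by grind) (by grind) (by grind) (by grind) du dx dw
      · have dx : G.degree x = 3 := degree_eq_length [u, w, b] (by simp; grind) (by grind)
        have dy : G.degree y = 3 := degree_eq_length [a, w, b] (by simp; grind) (by grind)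
        refine .of_strictAnti ![b, y, w, x, u, a] ![2, 3, 2, 3, 2, 2]
          (show G10 ∈ _ by simp) (by decide) (by decide) ?_ ?_ ?_ ?_
        · simp [strictAnti_vecCons, *]
        · simp [*]
        · simp; exact ⟨dy, dw, dx, du⟩
        · simp
  · by_cases q : G.Adj x y
    · have dy : G.degree y = 3 := degree_eq_length [a, x, w] (by simp; grind) (by grind)
      exact .of_G2 (by grind) (by grind) q.symm dw dy
    · have dy : G.degree y = 2 := degree_eq_length [a, w] (by simp; grind) (by grind)
      exact .of_G1 (by grind) dw dy

theorem crossing_one_one_one {a u x w y v b : V}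
    (hiso : Isolated G a b) (hau : a ⋖ u) (hux : u ⋖ x) (hxw : x ⋖ w)
    (hwy : w ⋖ y) (hyv : y ⋖ v) (hvb : v ⋖ b)
   
    (hu : Ear G a u x) (hw : Ear G x w y) (hv : Ear G y v b) (hay : G.Adj a y) (hxb : G.Adj x b) :
    HasConfiguration G := by
  have sym : ∀ s t, G.Adj s t → G.Adj t s := fun s t h => h.symm
  have irr : ∀ s, ¬ G.Adj s s := fun s => G.loopless.irrefl s
  have l1 := hau.lt
  have l2 := hux.lt
  have l3 := hxw.lt
  have l4 := hwy.lt
  have l5 := hyv.lt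
  have l6 := hvb.lt
  have hch : List.IsChain (· ⋖ ·) [a, u, x, w, y, v, b] := by simp [*]
  have hx := fun z => hiso.mem_of_adj hch (by simp) (x := x) (z := z) (by order) (by order)
  have hy := fun z => hiso.mem_of_adj hch (by simp) (x := y) (z := z) (by order) (by order)
  have du := hu.degree (by order) (by order)
  have dw := hw.degree (by order) (by order)
  have dv := hv.degree (by order) (by order)
  unfold Ear at hu hw hv
  by_cases q : G.Adj x y
  · by_cases p : G.Adj a x
    · by_cases r : G.Adj y b
      · have dx : G.degree x = 5 := degree_eq_length [a, u, w, y, b] (by simp; grind) (by grind)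
        have dy : G.degree y = 5 := degree_eq_length [a, x, w, v, b] (by simp; grind) (by grind)
        refine .of_strictMono ![a, u, x, w, y, v, b] ![3, 2, 5, 2, 5, 2, 3]
          (show G17 ∈ _ by simp) (by decide) (by decide) ?_ ?_ ?_ ?_
        · simp [strictMono_vecCons, *]
        · simp [*]
        · simp; exact ⟨du, dx, dw, dy, dv⟩
        · simp
      · have dy : G.degree y = 4 := degree_eq_length [a, x, w, v] (by simp; grind) (by grind)
        exact .of_G5 (a := x) (c := b) (d := a) (by simp; grind (splits := 20))
          (by grind) (by grind) (by grind) (by grind) (by grind) (by grind) dw dy dv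
    · have dx : G.degree x = 4 := degree_eq_length [u, w, y, b] (by simp; grind) (by grind)
      exact .of_G5 (a := y) (c := a) (d := b) (by simp; grind (splits := 20))
        (by grind) (by grind) (by grind) (by grind) (by grind) (by grind) dw dx du
  · by_cases p : G.Adj a x
    · have dx : G.degree x = 4 := degree_eq_length [a, u, w, b] (by simp; grind) (by grind)
      exact .of_G5 (a := a) (c := y) (d := b) (by simp; grind (splits := 20))
        (by grind) (by grind) (by grind) (by grind) (by grind) (by grind) du dx dw
    · by_cases r : G.Adj y b
      · have dy : G.degree y = 4 := degree_eq_length [a, w, v, b] (by simp; grind) (by grind)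
        exact .of_G5 (a := b) (c := x) (d := a) (by simp; grind (splits := 20))
          (by grind) (by grind) (by grind) (by grind) (by grind) (by grind) dv dy dw
      · have dx : G.degree x = 3 := degree_eq_length [u, w, b] (by simp; grind) (by grind)
        have dy : G.degree y = 3 := degree_eq_length [a, w, v] (by simp; grind) (by grind)
        refine .of_strictMono ![a, u, x, w, y, v, b] ![2, 2, 3, 2, 3, 2, 2]
          (show G11 ∈ _ by simp) (by decide) (by decide) ?_ ?_ ?_ ?_
        · simp [strictMono_vecCons, *]
        · simp [*]
        · simp; exact ⟨du, dx, dw, dy, dv⟩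
        · simp

/-- An interval spanned by two crossing edges whose three parts are short is tight, unless it
contains a configuration. -/
theorem hasConfiguration_or_tight (h1 : OneCrossing id G) (hδ : ∀ v, 2 ≤ G.degree v)
    {a x y b : V} (hiso : Isolated G a b) (hax : Short G a x) (hxy : Short G x y)
    (hyb : Short G y b) (hay : G.Adj a y) (hxb : G.Adj x b) :
    HasConfiguration G ∨ Tight G a b := by
  rcases hax with hax | ⟨u, hau, hux, hu⟩ <;> rcases hxy with hxy | ⟨w, hxw, hwy, hw⟩ <;>
    rcases hyb with hyb | ⟨v, hyv, hvb, hv⟩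
  · exact crossing_zero_zero_zero hδ hiso hax hxy hyb hay hxb
  · exact Or.inl (.of_swap (@crossing_one_zero_zero V (reverseOrder V) _ G _
      (OneCrossing.swap.2 h1) b v y x a hiso.swap (covBy_swap.2 hvb) (covBy_swap.2 hyv)
      (covBy_swap.2 hxy) (covBy_swap.2 hax) hv.symm hxb.symm hay.symm))
  · exact crossing_zero_one_zero hiso hax hxw hwy hyb hw hay hxb
  · exact Or.inl (.of_swap (@crossing_one_one_zero V (reverseOrder V) _ G _ b v y w x a hiso.swap
      (covBy_swap.2 hvb) (covBy_swap.2 hyv) (covBy_swap.2 hwy) (covBy_swap.2 hxw)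
      (covBy_swap.2 hax) hv.symm hw.symm hxb.symm hay.symm))
  · exact Or.inl (crossing_one_zero_zero h1 hiso hau hux hxy hyb hu hay hxb)
  · exact Or.inl (crossing_one_zero_one hiso hau hux hxy hyv hvb hu hv hay hxb)
  · exact Or.inl (crossing_one_one_zero hiso hau hux hxw hwy hyb hu hw hay hxb)
  · exact Or.inl (crossing_one_one_one hiso hau hux hxw hwy hyv hvb hu hw hv hay hxb)

end CrossingPair

/-! ### Composition of intervals -/

section Compose

variable {V : Type*} [LinearOrder V]

theorem Short.lt {G : SimpleGraph V} {a b : V} (h : Short G a b) : a < b := by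
  rcases h with h | ⟨u, h1, h2, -⟩
  exacts [h.lt, h1.lt.trans h2.lt]

/-- Inside an interval that is short or tight, the left end has at most three neighbours. -/
theorem exists_neighbors_left {G : SimpleGraph V} {a b : V} (h : Short G a b ∨ Tight G a b) :
    ∃ l : List V, l.length ≤ 3 ∧ ∀ z, a ≤ z → z ≤ b → G.Adj a z → z ∈ l := by
  have irr : ∀ s, ¬ G.Adj s s := fun s => G.loopless.irrefl s
  have inner : ∀ {l : List V}, List.IsChain (· ⋖ ·) (a :: l) → b ∈ a :: l →
      ∀ z, a ≤ z → z ≤ b → z ∈ a :: l := fun hl hb z h1 h2 =>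
    (mem_or_lt_of_isChain_covBy hl h1).resolve_right fun k => (k b hb).not_ge h2
  rcases h with (h | ⟨u, h1, h2, -⟩) | ⟨x, y, h1, h2, h3 | ⟨w, h3, h4, hw⟩, -⟩
  · have := inner (l := [b]) (by simp [h]) (by simp)
    exact ⟨[b], by simp, by grind⟩
  · have := inner (l := [u, b]) (by simp [h1, h2]) (by simp)
    exact ⟨[u, b], by simp, by grind⟩
  · have := inner (l := [x, y, b]) (by simp [h1, h2, h3]) (by simp)
    exact ⟨[x, y, b], by simp, by grind⟩
  · have := inner (l := [x, w, y, b]) (by simp [h1, h2, h3, h4]) (by simp)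
    have hwa : ¬ G.Adj a w := fun h => by
      rcases (hw a).1 h.symm with rfl | rfl
      · exact h1.lt.false
      · exact (h1.lt.trans (h3.lt.trans h4.lt)).false
    exact ⟨[x, y, b], by simp, by grind⟩

theorem exists_neighbors_right {G : SimpleGraph V} {a b : V} (h : Short G a b ∨ Tight G a b) :
    ∃ l : List V, l.length ≤ 3 ∧ ∀ z, a ≤ z → z ≤ b → G.Adj b z → z ∈ l := by
  obtain ⟨l, h1, h2⟩ := @exists_neighbors_left V (reverseOrder V) G b a
    (h.imp Short.swap Tight.swap)
  exact ⟨l, h1, fun z h3 h4 => h2 z h4 h3⟩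

variable [Fintype V] {G : SimpleGraph V} [DecidableRel G.Adj]

/-- If two consecutive intervals are short or tight, then at most six edges at their common end stay
inside them.  One more edge is allowed for, as `c` may be an end of a crossing edge. -/
theorem degree_le_seven {a c b e : V} (hac : Short G a c ∨ Tight G a c)
    (hcb : Short G c b ∨ Tight G c b) (h : ∀ z, G.Adj c z → z = e ∨ a ≤ z ∧ z ≤ b) :
    G.degree c ≤ 7 := by
  obtain ⟨l, hl, hl'⟩ := exists_neighbors_right hac
  obtain ⟨m, hm, hm'⟩ := exists_neighbors_left hcb
  refine (degree_le_length (e :: (l ++ m)) fun z hz => ?_).trans (by simp; omega)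
  rcases h z hz with rfl | ⟨h1, h2⟩
  · simp
  · rcases le_total z c with h3 | h3
    · simp [hl' z h1 h3 hz]
    · simp [hm' z h3 h2 hz]

/-- Two consecutive short intervals form a short interval, unless there is a configuration. -/
theorem hasConfiguration_or_short (hδ : ∀ v, 2 ≤ G.degree v) {a c b : V} (hiso : Isolated G a b)
    (hac : Short G a c) (hcb : Short G c b) : HasConfiguration G ∨ Short G a b := by
  have sym : ∀ s t, G.Adj s t → G.Adj t s := fun s t h => h.symm
  have irr : ∀ s, ¬ G.Adj s s := fun s => G.loopless.irrefl s
  have l1 := hac.lt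
  have l2 := hcb.lt
  have hc := hδ c
  -- If there is an inner vertex next to `c`, the degree of `c` decides: it gives `G1`, `G2` or `G4`
  -- according to whether it is `2`, `3` or `4`.
  rcases hac with hac | ⟨u, hau, huc, hu⟩ <;> rcases hcb with hcb | ⟨w, hcw, hwb, hw⟩
  · have hch : List.IsChain (· ⋖ ·) [a, c, b] := by simp [*]
    have hz := fun z => hiso.mem_of_adj hch (by simp) (x := c) (z := z) l1 l2
    right
    refine Or.inr ⟨c, hac, hcb, fun z => ⟨fun h => ?_, ?_⟩⟩
    · have := hz z h
      have := h.ne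
      simp only [List.mem_cons, List.not_mem_nil, or_false] at *
      tauto
    have ha : G.Adj c a := by
      by_contra ha
      have := hc.trans (degree_le_length [b] (by grind))
      simp at this
    have hb : G.Adj c b := by
      by_contra hb
      have := hc.trans (degree_le_length [a] (by grind))
      simp at this
    rintro (rfl | rfl)
    exacts [ha, hb]
  · have hch : List.IsChain (· ⋖ ·) [a, c, w, b] := by simp [*]
    have hz := fun z => hiso.mem_of_adj hch (by simp) (x := c) (z := z) l1 l2
    have m1 := hcw.lt
    have m2 := hwb.lt
    have dw := hw.degree m1 m2
    unfold Ear at hw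
    left
    by_cases p : G.Adj a c <;> by_cases q : G.Adj c b
    · have dc : G.degree c = 3 := degree_eq_length [a, w, b] (by simp; grind) (by grind)
      exact .of_G2 (by grind) (by grind) q dw dc
    · have dc : G.degree c = 2 := degree_eq_length [a, w] (by simp; grind) (by grind)
      exact .of_G1 (by grind) dw dc
    · have dc : G.degree c = 2 := degree_eq_length [w, b] (by simp; grind) (by grind)
      exact .of_G1 (by grind) dw dc
    · have := hc.trans (degree_le_length [w] (by grind))
      simp at this
  · have hch : List.IsChain (· ⋖ ·) [a, u, c, b] := by simp [*]
    have hz := fun z => hiso.mem_of_adj hch (by simp) (x := c) (z := z) l1 l2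
    have m1 := hau.lt
    have m2 := huc.lt
    have du := hu.degree m1 m2
    unfold Ear at hu
    left
    by_cases p : G.Adj a c <;> by_cases q : G.Adj c b
    · have dc : G.degree c = 3 := degree_eq_length [a, u, b] (by simp; grind) (by grind)
      exact .of_G2 (by grind) (by grind) p.symm du dc
    · have dc : G.degree c = 2 := degree_eq_length [a, u] (by simp; grind) (by grind)
      exact .of_G1 (by grind) du dc
    · have dc : G.degree c = 2 := degree_eq_length [u, b] (by simp; grind) (by grind)
      exact .of_G1 (by grind) du dc
    · have := hc.trans (degree_le_length [u] (by grind))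
      simp at this
  · have hch : List.IsChain (· ⋖ ·) [a, u, c, w, b] := by simp [*]
    have hz := fun z => hiso.mem_of_adj hch (by simp) (x := c) (z := z) l1 l2
    have m1 := hau.lt
    have m2 := huc.lt
    have m3 := hcw.lt
    have m4 := hwb.lt
    have du := hu.degree m1 m2
    have dw := hw.degree m3 m4
    unfold Ear at hu hw
    left
    by_cases p : G.Adj a c <;> by_cases q : G.Adj c b
    · have dc : G.degree c = 4 := degree_eq_length [a, u, w, b] (by simp; grind) (by grind)
      exact .of_G4 (a := a) (c := b) (by simp; grind (splits := 20)) (by grind) (by grind) p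
        (by grind) (by grind) q du dc dw
    · have dc : G.degree c = 3 := degree_eq_length [a, u, w] (by simp; grind) (by grind)
      exact .of_G2 (by grind) (by grind) p.symm du dc
    · have dc : G.degree c = 3 := degree_eq_length [u, w, b] (by simp; grind) (by grind)
      exact .of_G2 (by grind) (by grind) q dw dc
    · have dc : G.degree c = 2 := degree_eq_length [u, w] (by simp; grind) (by grind)
      exact .of_G1 (by grind) du dc

/-- Without a configuration, every isolated interval is short or tight. -/
theorem Isolated.short_or_tight (h1 : OneCrossing id G) (hδ : ∀ v, 2 ≤ G.degree v)
    (hno : ¬ HasConfiguration G) {a b : V} (hab : a < b) (hiso : Isolated G a b) :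
    Short G a b ∨ Tight G a b := by
  induction hn : (Set.Ioo a b).ncard using Nat.strong_induction_on generalizing a b with
  | _ n ih =>
  have smaller : ∀ {s t c : V}, s < t → a ≤ s → t ≤ b → a < c → c < b → c ≤ s ∨ t ≤ c →
      Isolated G s t → Short G s t ∨ Tight G s t := by
    intro s t c hst has htb hac hcb hc hiso'
    refine ih _ ?_ hst hiso' rfl
    rw [← hn]
    refine Set.ncard_lt_ncard ?_ (Set.toFinite _)
    refine (Set.ssubset_iff_of_subset (Set.Ioo_subset_Ioo has htb)).2 ⟨c, ⟨hac, hcb⟩, fun k => ?_⟩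
    rcases hc with hc | hc
    exacts [k.1.not_ge hc, k.2.not_ge hc]
  -- A tight part would contain a configuration, as its inner end has degree at most `7`.
  have noRight : ∀ {s t}, Tight G s t → Isolated G s t → ¬ G.degree t ≤ 7 := fun h k l =>
    hno (h.hasConfiguration_right h1 k l)
  have noLeft : ∀ {s t}, Tight G s t → Isolated G s t → ¬ G.degree s ≤ 7 := fun h k l =>
    hno (h.hasConfiguration_left h1 k l)
  rcases h1.decompose hab hiso with h | ⟨c, hac, hcb, i1, i2⟩ |
    ⟨x, y, hax, hxy, hyb, hay, hxb, i1, i2, i3⟩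
  · exact Or.inl (Or.inl h)
  · have s1 := smaller hac le_rfl hcb.le hac hcb (Or.inr le_rfl) i1
    have s2 := smaller hcb hac.le le_rfl hac hcb (Or.inl le_rfl) i2
    have hc : G.degree c ≤ 7 := degree_le_seven (e := a) s1 s2 fun z hz =>
      Or.inr (hiso c z hac hcb hz)
    have t1 := s1.resolve_right fun h => noRight h i1 hc
    have t2 := s2.resolve_right fun h => noLeft h i2 hc
    exact Or.inl ((hasConfiguration_or_short hδ hiso t1 t2).resolve_left hno)
  · have s1 := smaller hax le_rfl (hxy.trans hyb).le hax (hxy.trans hyb) (Or.inr le_rfl) i1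
    have s2 := smaller hxy hax.le hyb.le hax (hxy.trans hyb) (Or.inl le_rfl) i2
    have s3 := smaller hyb (hax.trans hxy).le le_rfl (hax.trans hxy) hyb (Or.inl le_rfl) i3
    have hx : G.degree x ≤ 7 := degree_le_seven (e := b) s1 s2 fun z hz => by
      have k := hiso x z hax (hxy.trans hyb) hz
      rcases le_or_gt z y with hzy | hzy
      · exact Or.inr ⟨k.1, hzy⟩
      · rcases k.2.eq_or_lt with e | hzb
        · exact Or.inl e
        · exact absurd (i3 z x hzy hzb hz.symm).1 hxy.not_ge
    have hy : G.degree y ≤ 7 := degree_le_seven (e := a) s2 s3 fun z hz => by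
      have k := hiso y z (hax.trans hxy) hyb hz
      rcases le_or_gt x z with hxz | hxz
      · exact Or.inr ⟨hxz, k.2⟩
      · rcases k.1.eq_or_lt with e | haz
        · exact Or.inl e.symm
        · exact absurd (i1 z y haz hxz hz.symm).2 hxy.not_ge
    have t1 := s1.resolve_right fun h => noRight h i1 hx
    have t2 := s2.resolve_right fun h => noLeft h i2 hx
    have t3 := s3.resolve_right fun h => noLeft h i3 hy
    exact Or.inr ((hasConfiguration_or_tight h1 hδ hiso t1 t2 t3 hay hxb).resolve_left hno)

/-- The theorem for a graph on a line: the interval between the first and the last vertex is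
isolated, and if it is short or tight, then its ends have small degree. -/
theorem OneCrossing.hasConfiguration [Nontrivial V] (h1 : OneCrossing id G)
    (hδ : ∀ v, 2 ≤ G.degree v) : HasConfiguration G := by
  by_contra hno
  obtain ⟨a, ha⟩ := Finite.exists_min (id : V → V)
  obtain ⟨b, hb⟩ := Finite.exists_max (id : V → V)
  simp only [id] at ha hb
  have hab : a < b := by
    refine lt_of_le_of_ne (ha b) ?_
    rintro rfl
    obtain ⟨c, hc⟩ := exists_ne a
    exact hc (le_antisymm (hb c) (ha c))
  have hiso : Isolated G a b := fun x y _ _ _ => ⟨ha y, hb y⟩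
  have irr : ∀ s, ¬ G.Adj s s := fun s => G.loopless.irrefl s
  have hst := hiso.short_or_tight h1 hδ hno hab
  rcases hst with (h | ⟨u, hau, hub, hu⟩) | h
  · have := (hδ a).trans (degree_le_length [b] fun z hz => by
      have := mem_or_lt_of_isChain_covBy (l := [b]) (by simpa using h) (ha z)
        |>.resolve_right fun k => (k b (by simp)).not_ge (hb z)
      grind)
    simp at this
  · have da : G.degree a ≤ 2 := degree_le_length [u, b] fun z hz => by
      have := mem_or_lt_of_isChain_covBy (l := [u, b]) (by simp [hau, hub]) (ha z)
        |>.resolve_right fun k => (k b (by simp)).not_ge (hb z)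
      grind
    have hua : G.Adj u a := (hu a).2 (Or.inl rfl)
    exact hno (.of_G1 hua (hu.degree hau.lt hub.lt) (le_antisymm da (hδ a)))
  · obtain ⟨l, hl, hl'⟩ := exists_neighbors_right (Or.inr h)
    have db : G.degree b ≤ 7 :=
      (degree_le_length l fun z hz => hl' z (ha z) (hb z) hz).trans (by omega)
    exact hno (h.hasConfiguration_right h1 hiso db)

end Compose

end OuterOnePlane

theorem theorem2p4 {V : Type*} [Fintype V] (G : SimpleGraph V) [DecidableRel G.Adj]
    (D : OuterOnePlane.Drawing G) (hG : 2 ≤ G.minDegree) :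
    (∃ P ∈ [OuterOnePlane.G1, OuterOnePlane.G2, OuterOnePlane.G4, OuterOnePlane.G5],
      ∃ f : Fin P.size → V, OuterOnePlane.IsCopy G P f) ∨
    (∃ f : Fin 4 → V, OuterOnePlane.IsCopy G OuterOnePlane.G3 f ∧
      OuterOnePlane.IsOuterOnePlanar (G ⊔ SimpleGraph.edge (f 1) (f 2))) ∨
    (∃ P ∈ [OuterOnePlane.G6, OuterOnePlane.G7, OuterOnePlane.G8, OuterOnePlane.G9,
        OuterOnePlane.G10, OuterOnePlane.G11, OuterOnePlane.G12, OuterOnePlane.G13,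
        OuterOnePlane.G14, OuterOnePlane.G15, OuterOnePlane.G16, OuterOnePlane.G17],
      ∃ f : Fin P.size → V, OuterOnePlane.IsCopy G P f ∧ D.IsPartialDrawing f) := by
  have hinj : Function.Injective fun v => Complex.arg (D.pos v) :=
    Circle.injective_arg.comp D.pos_injective
  let _ : LinearOrder V := LinearOrder.lift' _ hinj
  have hδ : ∀ v, 2 ≤ G.degree v := fun v => hG.trans (G.minDegree_le_degree v)
  have : Nontrivial V := by
    by_contra h
    have := not_nontrivial_iff_subsingleton.1 h
    rw [SimpleGraph.minDegree_of_subsingleton] at hG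
    omega
  have h1 : OuterOnePlane.OneCrossing (id : V → V) G := D.oneCrossing
  rcases h1.hasConfiguration hδ with h | ⟨f, hf, σ, hσ⟩ | ⟨P, hP, f, hf, hm⟩
  · exact Or.inl h
  · exact Or.inr (Or.inl ⟨f, hf, OuterOnePlane.isOuterOnePlanar_of_oneCrossing
      (pos := fun v => D.pos (σ v)) (D.pos_injective.comp σ.injective) hσ⟩)
  · refine Or.inr (Or.inr ⟨P, hP, f, hf, ?_⟩)
    rcases hm with hm | hm
    · exact Or.inl fun i j l hij hjl => OuterOnePlane.orient_pos_of_arg (hm hij) (hm hjl)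
    · exact Or.inr fun i j l hij hjl => OuterOnePlane.orient_pos_of_arg (hm hjl) (hm hij)
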